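/- Let $m,n\ge 0$, $\Lambda\in\{-1,0,1\}$, let $\eta=\mathrm{diag}(-1,\dots,-1,1,\dots,1)$ be the standard metric of signature $(m,n)$ ($m$ times $-1$, $n$ times $+1$) on $\mathfrak z=\mathbb R^{m+n}$, let $H=\mathrm O(m,n)$ with Lie algebra $\mathfrak h=\mathfrak o(m,n)$, and let $G=\mathrm O(m,n+1)$, $\mathrm{IO}(m,n)=\mathrm O(m,n)\ltimes\mathbb R^{m,n}$, $\mathrm O(m+1,n)$ for $\Lambda=1,0,-1$, respectively. Its Lie algebra is $\mathfrak g=\mathfrak h\oplus\mathfrak z$ with $[h,h']=hh'-h'h$, $[h,z]=hz$, $[z,z']=\Lambda\,(\eta(z,\cdot)z'-\eta(z',\cdot)z)$, and $\mathrm{Ad}(k)(h+z)=khk^{-1}+kz$ for $k\in H$. Let $M$ be a smooth manifold of dimension $m+n$ and let $(\pi:P\to M,A)$ be a Cartan geometry modeled on $G/H$, that is, a smooth principal $H$-bundle with a smooth one-form $A\in\Omega^1(P,\mathfrak g)$ such that each $A_p:T_pP\to\mathfrak g$ is a linear isomorphism, $(R_k)^*A=\mathrm{Ad}(k^{-1})\circ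 A$ for all $k\in H$, and $A(\tilde h)=h$ for the fundamental vector field $\tilde h$ of every $h\in\mathfrak h$. Write $A=\omega+e$ with $\omega$ $\mathfrak h$-valued and $e$ $\mathfrak z$-valued. Each $p\in P$ defines an admissible frame $\phi(p):\mathfrak z\to T_{\pi(p)}M$, the linear bijection with $\phi(p)(e(w))=\pi_*(w)$ for all $w\in T_pP$; the map $\phi$ identifies $P$ with a subbundle $\phi(P)$ of the frame bundle $\mathrm{GL}(M)$ (if $P\subset\mathrm{GL}(M)$ and $e$ is the solder form, then $\phi$ is the inclusion). The associated metric $g$ on $M$ is $g(v,v')=\eta(\phi(p)^{-1}v,\phi(p)^{-1}v')$ for $v,v'\in T_xM$ and any $p\in P$ with $\pi(p)=x$. Assume that the geometry is torsion-free: the curvature $F=dA+\frac12[A,A]$ takes values in $\mathfrak h$. For a smooth vector field $\xi$ on $M$ let $\bar\xi=\xi^a\frac{\partial}{\partial x^a}+f_i^b\,\partial_b\xi^a\frac{\partial}{\partial f_i^a}$ be its complete lift to $\mathrm{GL}(M)$. The Cartan geometry is called invariant under $\xi$ if $\bar\xi$ is tangent to $\phi(P)$ and $\mathcal L_{\bar\xi}\tilde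 A=0$ on $\phi(P)$, where $\tilde A=(\phi^{-1})^*A$. Then, for every smooth vector field $\xi$ on $M$, the Cartan geometry is invariant under $\xi$ if and only if the associated metric is invariant under $\xi$, $\mathcal L_\xi g=0$ (i.e. $\xi$ is a Killing vector field of $g$). -/

import Mathlib

open Set Bundle VectorField
open scoped Manifold ContDiff Topology

noncomputable section

namespace OrthogonalCartan

/-! ### The orthogonal model geometries

`H = O(m,n)` and `G = O(m,n+1)`, `IO(m,n)`, `O(m+1,n)` for `Λ = 1, 0, -1`. -/

/-- The vector space `𝔷 = ℝ^{m,n}`; its first `m` coordinates are the negative directions of the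
standard metric `η`. -/
abbrev Z (m n : ℕ) : Type := EuclideanSpace ℝ (Fin m ⊕ Fin n)

/-- The standard metric `η` on `ℝ^{m,n}`: `m` times `-1` and `n` times `+1`. -/
def eta {m n : ℕ} (z w : Z m n) : ℝ :=
  -∑ i : Fin m, z (Sum.inl i) * w (Sum.inl i) + ∑ j : Fin n, z (Sum.inr j) * w (Sum.inr j)

lemma eta_add_left {m n : ℕ} (z z' w : Z m n) : eta (z + z') w = eta z w + eta z' w := by
  simp [eta, add_mul, Finset.sum_add_distrib]; ring

lemma eta_smul_left {m n : ℕ} (c : ℝ) (z w : Z m n) : eta (c • z) w = c * eta z w := by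
  simp [eta, mul_assoc, ← Finset.mul_sum]; ring

lemma eta_comm {m n : ℕ} (z w : Z m n) : eta z w = eta w z := by
  simp [eta, mul_comm]

lemma eta_add_right {m n : ℕ} (z w w' : Z m n) : eta z (w + w') = eta z w + eta z w' := by
  rw [eta_comm, eta_add_left, eta_comm w, eta_comm w']

lemma eta_smul_right {m n : ℕ} (c : ℝ) (z w : Z m n) : eta z (c • w) = c * eta z w := by
  rw [eta_comm, eta_smul_left, eta_comm w]

/-- `η` with its second argument fixed, as a continuous linear form in the first argument. -/
def etaLeft {m n : ℕ} (w : Z m n) : Z m n →L[ℝ] ℝ :=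
  LinearMap.toContinuousLinearMap
    { toFun := fun z => eta z w
      map_add' := fun z z' => eta_add_left z z' w
      map_smul' := fun c z => eta_smul_left c z w }

@[simp] lemma etaLeft_apply {m n : ℕ} (z w : Z m n) : etaLeft w z = eta z w := rfl

/-- The group `H = O(m,n)` of linear isometries of `(ℝ^{m,n}, η)`. -/
def O (m n : ℕ) : Subgroup (Z m n ≃L[ℝ] Z m n) where
  carrier := {k | ∀ z w, eta (k z) (k w) = eta z w}
  mul_mem' := by
    intro a b ha hb z w
    exact (ha (b z) (b w)).trans (hb z w)
  one_mem' := fun _ _ => rfl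
  inv_mem' := by
    intro a ha z w
    have h := ha (a.symm z) (a.symm w)
    simp only [ContinuousLinearEquiv.apply_symm_apply] at h
    exact h.symm

/-- An element of `O(m,n)` as an endomorphism of `ℝ^{m,n}`. -/
def toEnd {m n : ℕ} (k : O m n) : Z m n →L[ℝ] Z m n := (k : Z m n ≃L[ℝ] Z m n)

/-- The Lie algebra `𝔥 = 𝔬(m,n)` of `H`: the endomorphisms of `ℝ^{m,n}` that are skew for `η`. -/
def o (m n : ℕ) : Submodule ℝ (Z m n →L[ℝ] Z m n) where
  carrier := {h | ∀ z w, eta (h z) w + eta z (h w) = 0}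
  add_mem' := by
    intro a b ha hb z w
    have h1 := ha z w
    have h2 := hb z w
    simp only [add_apply, eta_add_left, eta_add_right]
    linarith
  zero_mem' := by
    intro z w
    simp [eta]
  smul_mem' := by
    intro c a ha z w
    have h1 := ha z w
    simp only [smul_apply, eta_smul_left, eta_smul_right]
    rw [← mul_add, h1, mul_zero]

lemma comm_mem_o {m n : ℕ} {h k : Z m n →L[ℝ] Z m n} (hh : h ∈ o m n) (hk : k ∈ o m n) :
    h * k - k * h ∈ o m n := by
  intro z w
  have e1 := hh (k z) w
  have e2 := hk z (h w)
  have e3 := hk (h z) w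
  have e4 := hh z (k w)
  have s1 : ∀ a b c : Z m n, eta (a - b) c = eta a c - eta b c := fun a b c =>
    (etaLeft c).map_sub a b
  have s2 : ∀ a b c : Z m n, eta c (a - b) = eta c a - eta c b := fun a b c => by
    rw [eta_comm, s1, eta_comm a, eta_comm b]
  simp only [sub_apply, mul_apply_eq_comp, s1, s2]
  linarith

/-- The endomorphism `v ↦ η(z, v) z' - η(z', v) z`, an element of `𝔬(m,n)`. -/
def wedge {m n : ℕ} (z z' : Z m n) : Z m n →L[ℝ] Z m n :=
  (etaLeft z).smulRight z' - (etaLeft z').smulRight z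

lemma wedge_mem_o {m n : ℕ} (z z' : Z m n) : wedge z z' ∈ o m n := by
  intro v w
  have s1 : ∀ a b c : Z m n, eta (a - b) c = eta a c - eta b c := fun a b c =>
    (etaLeft c).map_sub a b
  have s2 : ∀ a b c : Z m n, eta c (a - b) = eta c a - eta c b := fun a b c => by
    rw [eta_comm, s1, eta_comm a, eta_comm b]
  simp only [wedge, sub_apply, ContinuousLinearMap.smulRight_apply,
    etaLeft_apply, s1, s2, eta_smul_left, eta_smul_right]
  rw [eta_comm z' w, eta_comm z w]
  ring

lemma conj_mem_o {m n : ℕ} (k : O m n) {h : Z m n →L[ℝ] Z m n} (hh : h ∈ o m n) :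
    toEnd k * h * toEnd k⁻¹ ∈ o m n := by
  intro z w
  have e : ∀ v : Z m n, (toEnd k) (toEnd k⁻¹ v) = v := fun v =>
    (k : Z m n ≃L[ℝ] Z m n).apply_symm_apply v
  have i : ∀ v w : Z m n, eta (toEnd k v) (toEnd k w) = eta v w := fun v w => k.2 v w
  have h0 := hh (toEnd k⁻¹ z) (toEnd k⁻¹ w)
  have h1 := i (h (toEnd k⁻¹ z)) (toEnd k⁻¹ w)
  have h2 := i (toEnd k⁻¹ z) (h (toEnd k⁻¹ w))
  rw [e] at h1 h2
  simp only [mul_apply_eq_comp]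
  rw [h1, h2, h0]

/-- The space underlying `𝔥 = 𝔬(m,n)`, with the operator norm. -/
def OAlgebra (m n : ℕ) : Type := ↥(o m n)

instance (m n : ℕ) : NormedAddCommGroup (OAlgebra m n) :=
  inferInstanceAs (NormedAddCommGroup ↥(o m n))

instance (m n : ℕ) : NormedSpace ℝ (OAlgebra m n) :=
  inferInstanceAs (NormedSpace ℝ ↥(o m n))

instance (m n : ℕ) : FiniteDimensional ℝ (OAlgebra m n) :=
  inferInstanceAs (FiniteDimensional ℝ ↥(o m n))

/-- A skew endomorphism of `ℝ^{m,n}` as an element of `𝔥`. -/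
def mkO {m n : ℕ} (h : Z m n →L[ℝ] Z m n) (hh : h ∈ o m n) : OAlgebra m n := ⟨h, hh⟩

/-- The inclusion of `𝔥` in the endomorphisms of `ℝ^{m,n}`. -/
def valO {m n : ℕ} : OAlgebra m n →L[ℝ] (Z m n →L[ℝ] Z m n) := (o m n).subtypeL

lemma valO_mem {m n : ℕ} (h : OAlgebra m n) : valO h ∈ o m n := Subtype.property h

/-- The Lie algebra `𝔤 = 𝔥 ⊕ 𝔷` of `G`. As a representation of `H` it does not depend on `Λ`, which
only enters in the Lie bracket, see `bracket`. -/
def KleinAlgebra (m n : ℕ) : Type := (OAlgebra m n) × Z m n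

instance (m n : ℕ) : NormedAddCommGroup (KleinAlgebra m n) :=
  inferInstanceAs (NormedAddCommGroup ((OAlgebra m n) × Z m n))

instance (m n : ℕ) : NormedSpace ℝ (KleinAlgebra m n) :=
  inferInstanceAs (NormedSpace ℝ ((OAlgebra m n) × Z m n))

instance (m n : ℕ) : FiniteDimensional ℝ (KleinAlgebra m n) :=
  inferInstanceAs (FiniteDimensional ℝ ((OAlgebra m n) × Z m n))

/-- The inclusion `𝔥 → 𝔤`. -/
def inclH {m n : ℕ} : OAlgebra m n →L[ℝ] KleinAlgebra m n :=
  ContinuousLinearMap.inl ℝ (OAlgebra m n) (Z m n)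

/-- The inclusion `𝔷 → 𝔤`. -/
def inclZ {m n : ℕ} : Z m n →L[ℝ] KleinAlgebra m n :=
  ContinuousLinearMap.inr ℝ (OAlgebra m n) (Z m n)

/-- The projection of `𝔤 = 𝔥 ⊕ 𝔷` to `𝔥`. -/
def projH {m n : ℕ} : KleinAlgebra m n →L[ℝ] OAlgebra m n :=
  ContinuousLinearMap.fst ℝ (OAlgebra m n) (Z m n)

/-- The projection of `𝔤 = 𝔥 ⊕ 𝔷` to `𝔷`. -/
def projZ {m n : ℕ} : KleinAlgebra m n →L[ℝ] Z m n :=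
  ContinuousLinearMap.snd ℝ (OAlgebra m n) (Z m n)

lemma inclH_add_inclZ {m n : ℕ} (a : KleinAlgebra m n) : inclH (projH a) + inclZ (projZ a) = a :=
  Prod.ext (add_zero a.1) (zero_add a.2)

/-- The Lie bracket of `𝔤` for the model with parameter `Λ ∈ {-1, 0, 1}`:
`[h, h'] = hh' - h'h`, `[h, z] = h z` and `[z, z'] = Λ (η(z, ·) z' - η(z', ·) z)`. -/
def bracket {m n : ℕ} (Λ : SignType) (a b : KleinAlgebra m n) : KleinAlgebra m n :=
  inclH (mkO (valO (projH a) * valO (projH b) - valO (projH b) * valO (projH a))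
      (comm_mem_o (valO_mem _) (valO_mem _)))
    + (Λ : ℝ) • inclH (mkO (wedge (projZ a) (projZ b)) (wedge_mem_o _ _))
    + inclZ (valO (projH a) (projZ b) - valO (projH b) (projZ a))

/-- The adjoint representation of `H ⊂ G` on `𝔤 = 𝔥 ⊕ 𝔷`: `Ad(k)(h + z) = k h k⁻¹ + k z`. -/
def Ad {m n : ℕ} (k : O m n) (a : KleinAlgebra m n) : KleinAlgebra m n :=
  inclH (mkO (toEnd k * valO (projH a) * toEnd k⁻¹) (conj_mem_o k (valO_mem _)))
    + inclZ (toEnd k (projZ a))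

lemma projZ_Ad {m n : ℕ} (k : O m n) (a : KleinAlgebra m n) :
    projZ (Ad k a) = toEnd k (projZ a) :=
  zero_add _

lemma eta_pow {m n : ℕ} {h : Z m n →L[ℝ] Z m n} (hh : h ∈ o m n) (r : ℕ) (z w : Z m n) :
    eta ((h ^ r) z) w = eta z (((-h) ^ r) w) := by
  induction r generalizing z w with
  | zero => rfl
  | succ r ih =>
    rw [pow_succ', pow_succ, mul_apply_eq_comp, mul_apply_eq_comp, ← ih]
    have h0 := hh ((h ^ r) z) w
    have h1 : eta ((h ^ r) z) ((-h) w) = - eta ((h ^ r) z) (h w) := by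
      have : (-h) w = (-1 : ℝ) • h w := by simp
      rw [this, eta_smul_right]; ring
    linarith

lemma eta_exp {m n : ℕ} {h : Z m n →L[ℝ] Z m n} (hh : h ∈ o m n) (z w : Z m n) :
    eta (NormedSpace.exp h z) w = eta z (NormedSpace.exp (-h) w) := by
  have key : ∀ (g : Z m n →L[ℝ] Z m n) (v u : Z m n),
      HasSum (fun r : ℕ => ((r.factorial : ℝ)⁻¹) * eta ((g ^ r) v) u)
        (eta (NormedSpace.exp g v) u) := by
    intro g v u
    have h1 := NormedSpace.exp_series_hasSum_exp' (𝕂 := ℝ) g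
    have h2 := ((etaLeft u).comp (ContinuousLinearMap.apply ℝ (Z m n) v)).hasSum h1
    simpa [Function.comp_def, eta_smul_left] using h2
  have k1 := key h z w
  have k2 := key (-h) w z
  refine k1.unique ?_
  rw [eta_comm]
  convert k2 using 3 with r
  rw [eta_pow hh, eta_comm]

lemma exp_neg_mul_exp {m n : ℕ} (h : Z m n →L[ℝ] Z m n) :
    NormedSpace.exp (-h) * NormedSpace.exp h = 1 := by
  rw [← NormedSpace.exp_add_of_commute_of_mem_ball (𝕂 := ℝ) (Commute.refl h).neg_left
    ((NormedSpace.expSeries_radius_eq_top ℝ (Z m n →L[ℝ] Z m n)).symm ▸ edist_lt_top _ _)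
    ((NormedSpace.expSeries_radius_eq_top ℝ (Z m n →L[ℝ] Z m n)).symm ▸ edist_lt_top _ _)]
  simp [NormedSpace.exp_zero]

/-- The exponential map `𝔥 → H`. -/
def expO {m n : ℕ} (h : OAlgebra m n) : O m n :=
  ⟨ContinuousLinearEquiv.equivOfInverse
      (NormedSpace.exp (valO h)) (NormedSpace.exp (-valO h))
      (fun z => by rw [← mul_apply_eq_comp, exp_neg_mul_exp]; rfl)
      (fun z => by
        have e := exp_neg_mul_exp (-valO h)
        rw [neg_neg] at e
        rw [← mul_apply_eq_comp, e]; rfl), by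
    intro z w
    change eta (NormedSpace.exp (valO h) z)
      (NormedSpace.exp (valO h) w) = eta z w
    rw [eta_exp (valO_mem h), ← mul_apply_eq_comp, exp_neg_mul_exp]; rfl⟩

/-! ### Lie derivatives, exterior derivative and complete lift

All manifolds are modelled on finite-dimensional vector spaces (no boundary). -/

section Calculus

variable {E : Type*} [NormedAddCommGroup E] [NormedSpace ℝ E] [FiniteDimensional ℝ E]
  {M : Type*} [TopologicalSpace M] [ChartedSpace E M] [IsManifold 𝓘(ℝ, E) ∞ M]
  {F : Type*} [NormedAddCommGroup F] [NormedSpace ℝ F]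

/-- The vector field `X` on `M` is smooth at the point `x`. -/
def SmoothFieldAt (X : Π x : M, TangentSpace 𝓘(ℝ, E) x) (x : M) : Prop :=
  ContMDiffAt 𝓘(ℝ, E) 𝓘(ℝ, E).tangent ∞ (fun y => (⟨y, X y⟩ : TangentBundle 𝓘(ℝ, E) M)) x

/-- The vector field `X` on `M` is smooth. -/
def SmoothField (X : Π x : M, TangentSpace 𝓘(ℝ, E) x) : Prop :=
  ∀ x, SmoothFieldAt X x

/-- The derivative `X(f)` at `x` of a vector-valued function `f` along the vector field `X`. -/
def dirDeriv (X : Π x : M, TangentSpace 𝓘(ℝ, E) x) (f : M → F) (x : M) : F :=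
  mfderiv 𝓘(ℝ, E) 𝓘(ℝ, F) f x (X x)

/-- `(L_X α)(Y) = X(α(Y)) - α([X, Y])` at `x`, for an `F`-valued one-form `α`. -/
def lieDerivForm (X : Π x : M, TangentSpace 𝓘(ℝ, E) x)
    (α : Π x : M, TangentSpace 𝓘(ℝ, E) x → F) (Y : Π x : M, TangentSpace 𝓘(ℝ, E) x) (x : M) : F :=
  dirDeriv X (fun y => α y (Y y)) x - α x (mlieBracket 𝓘(ℝ, E) X Y x)

/-- `dα(X, Y) = X(α(Y)) - Y(α(X)) - α([X, Y])` at `x`, for an `F`-valued one-form `α`. -/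
def extDerivForm (α : Π x : M, TangentSpace 𝓘(ℝ, E) x → F)
    (X Y : Π x : M, TangentSpace 𝓘(ℝ, E) x) (x : M) : F :=
  dirDeriv X (fun y => α y (Y y)) x - dirDeriv Y (fun y => α y (X y)) x
    - α x (mlieBracket 𝓘(ℝ, E) X Y x)

/-- `(L_ξ g)(Y, Z) = ξ(g(Y, Z)) - g([ξ, Y], Z) - g(Y, [ξ, Z])` at `x`, for a tensor field `g` of
type `(0,2)`. -/
def lieDerivMetric (ξ : Π x : M, TangentSpace 𝓘(ℝ, E) x)
    (g : Π x : M, TangentSpace 𝓘(ℝ, E) x → TangentSpace 𝓘(ℝ, E) x → ℝ)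
    (Y W : Π x : M, TangentSpace 𝓘(ℝ, E) x) (x : M) : ℝ :=
  dirDeriv ξ (fun y => g y (Y y) (W y)) x
    - g x (mlieBracket 𝓘(ℝ, E) ξ Y x) (W x) - g x (Y x) (mlieBracket 𝓘(ℝ, E) ξ W x)

/-- `L_ξ g = 0`: the Lie derivative vanishes at every point, on all locally defined smooth vector
fields. -/
def IsKilling (ξ : Π x : M, TangentSpace 𝓘(ℝ, E) x)
    (g : Π x : M, TangentSpace 𝓘(ℝ, E) x → TangentSpace 𝓘(ℝ, E) x → ℝ) : Prop :=
  ∀ (x : M) (Y W : Π x : M, TangentSpace 𝓘(ℝ, E) x),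
    SmoothFieldAt Y x → SmoothFieldAt W x → lieDerivMetric ξ g Y W x = 0

/-- The vector bundle `Hom(ℝ^{m,n}, TM)` over `M`. The frame bundle `GL(M)` is the open subset of
the linear bijections `ℝ^{m,n} → T_xM`. The chart at `f` is given by the induced coordinates
`(x^a, f_i^a)` of the chart of `M` at the base point of `f`. -/
abbrev FrameSpace (m n : ℕ) (E M : Type*) [NormedAddCommGroup E] [NormedSpace ℝ E]
    [TopologicalSpace M] [ChartedSpace E M] : Type _ :=
  TotalSpace (Z m n →L[ℝ] E) (fun x : M => Z m n →L[ℝ] TangentSpace 𝓘(ℝ, E) x)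

/-- The model with corners of the manifold `FrameSpace m n E M`. -/
abbrev frameModel (m n : ℕ) (E : Type*) [NormedAddCommGroup E] [NormedSpace ℝ E] :
    ModelWithCorners ℝ (E × (Z m n →L[ℝ] E)) (ModelProd E (Z m n →L[ℝ] E)) :=
  𝓘(ℝ, E).prod 𝓘(ℝ, Z m n →L[ℝ] E)

/-- The complete lift of a vector field `ξ` on `M` to the frame bundle,
`ξ^a ∂_a + f_i^b ∂_b ξ^a ∂/∂f_i^a` in the induced coordinates. It generates the flow
`f ↦ φ_{t*} ∘ f` on frames, where `φ_t` is the flow of `ξ`. -/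
def completeLift {m n : ℕ} (ξ : Π x : M, TangentSpace 𝓘(ℝ, E) x) (f : FrameSpace m n E M) :
    TangentSpace (frameModel m n E) f :=
  (ξ f.proj,
    (fderiv ℝ (mpullback 𝓘(ℝ, E) 𝓘(ℝ, E) (extChartAt 𝓘(ℝ, E) f.proj).symm ξ)
      (extChartAt 𝓘(ℝ, E) f.proj f.proj)).comp f.snd)

end Calculus

/-! ### Cartan geometries modeled on the orthogonal Klein geometries -/

section Geometry

/-- A smooth principal bundle `P → M` with structure group `H = O(m,n)`. Smoothness of the action
`P × H → P` is expressed through smooth families in `H` (such as the inverses of its charts),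
where `H` carries its structure of an embedded submanifold of `End(ℝ^{m,n})`. -/
structure PrincipalBundle (m n : ℕ)
    (E : Type*) [NormedAddCommGroup E] [NormedSpace ℝ E]
    (M : Type*) [TopologicalSpace M] [ChartedSpace E M]
    (E' : Type*) [NormedAddCommGroup E'] [NormedSpace ℝ E']
    (P : Type*) [TopologicalSpace P] [ChartedSpace E' P] where
  /-- the projection `π` -/
  proj : P → M
  /-- the right action `R_k p = act p k` -/
  act : P → O m n → P
  smooth_proj : ContMDiff 𝓘(ℝ, E') 𝓘(ℝ, E) ∞ proj
  act_one : ∀ p, act p 1 = p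
  act_mul : ∀ p k l, act p (k * l) = act (act p k) l
  proj_act : ∀ p k, proj (act p k) = proj p
  smooth_act : ∀ (r : ℕ) (c : EuclideanSpace ℝ (Fin r) → O m n),
    ContDiff ℝ ∞ (fun u => toEnd (c u)) →
    ContMDiff (𝓘(ℝ, E').prod 𝓘(ℝ, EuclideanSpace ℝ (Fin r))) 𝓘(ℝ, E') ∞
      (fun q : P × EuclideanSpace ℝ (Fin r) => act q.1 (c q.2))
  /-- Over an open neighbourhood `U` of each point there is an equivariant diffeomorphism
  `U × H ≃ π⁻¹(U)`, `(y, k) ↦ s(y) k` with inverse `p ↦ (π(p), τ(p))`. -/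
  locally_trivial : ∀ x : M, ∃ (U : Set M) (s : M → P) (τ : P → O m n),
    IsOpen U ∧ x ∈ U ∧
    ContMDiffOn 𝓘(ℝ, E) 𝓘(ℝ, E') ∞ s U ∧
    ContMDiffOn 𝓘(ℝ, E') 𝓘(ℝ, Z m n →L[ℝ] Z m n) ∞ (fun p => toEnd (τ p)) (proj ⁻¹' U) ∧
    (∀ y ∈ U, proj (s y) = y) ∧
    (∀ p, proj p ∈ U → act (s (proj p)) (τ p) = p) ∧
    (∀ y ∈ U, ∀ k, τ (act (s y) k) = k)

/-- A Cartan geometry `(π : P → M, A)` modeled on the orthogonal Klein geometry `G/H` with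
parameter `Λ`: a principal `H`-bundle with a smooth `𝔤`-valued one-form `A` that is a linear
isomorphism at every point, is `H`-equivariant, and reproduces the generators of the fundamental
vector fields. These conditions see `𝔤` only as a representation of `H`, which does not depend on
`Λ`; the parameter `Λ` enters in the curvature. -/
structure CartanGeometry (Λ : SignType) (m n : ℕ)
    (E : Type*) [NormedAddCommGroup E] [NormedSpace ℝ E]
    (M : Type*) [TopologicalSpace M] [ChartedSpace E M]
    (E' : Type*) [NormedAddCommGroup E'] [NormedSpace ℝ E']
    (P : Type*) [TopologicalSpace P] [ChartedSpace E' P] [IsManifold 𝓘(ℝ, E') ∞ P]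
    extends PrincipalBundle m n E M E' P where
  /-- the Cartan connection, a linear isomorphism `A_p : T_pP → 𝔤` for every `p` -/
  A : ∀ p : P, TangentSpace 𝓘(ℝ, E') p ≃L[ℝ] KleinAlgebra m n
  smooth_A : ContMDiff 𝓘(ℝ, E') (𝓘(ℝ, E').prod 𝓘(ℝ, E' →L[ℝ] KleinAlgebra m n)) ∞
    (fun p => (⟨p, (A p : TangentSpace 𝓘(ℝ, E') p →L[ℝ] KleinAlgebra m n)⟩ :
      TotalSpace (E' →L[ℝ] KleinAlgebra m n)
        (fun p : P => TangentSpace 𝓘(ℝ, E') p →L[ℝ] Trivial P (KleinAlgebra m n) p)))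
  /-- `(R_k)^* A = Ad(k⁻¹) ∘ A` -/
  equivariant : ∀ (k : O m n) (p : P) (w : TangentSpace 𝓘(ℝ, E') p),
    A (act p k) (mfderiv 𝓘(ℝ, E') 𝓘(ℝ, E') (fun q => act q k) p w) = Ad k⁻¹ (A p w)
  /-- `A` maps the value `d/dt p exp(t h)` at `t = 0` of the fundamental vector field of `h ∈ 𝔥`
  to `h` -/
  fundamental : ∀ (h : OAlgebra m n) (p : P),
    A (act p (expO ((0 : ℝ) • h)))
      (mfderiv 𝓘(ℝ, ℝ) 𝓘(ℝ, E') (fun t : ℝ => act p (expO (t • h))) 0 (1 : ℝ)) = inclH h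

namespace CartanGeometry

variable {Λ : SignType} {m n : ℕ}
  {E : Type*} [NormedAddCommGroup E] [NormedSpace ℝ E]
  {M : Type*} [TopologicalSpace M] [ChartedSpace E M]
  {E' : Type*} [NormedAddCommGroup E'] [NormedSpace ℝ E']
  {P : Type*} [TopologicalSpace P] [ChartedSpace E' P] [IsManifold 𝓘(ℝ, E') ∞ P]

/-- The value at `p` of the Cartan curvature `F = dA + 1/2 [A, A]` on two vector fields. -/
def curvature (C : CartanGeometry Λ m n E M E' P) (X Y : Π p : P, TangentSpace 𝓘(ℝ, E') p)
    (p : P) : KleinAlgebra m n :=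
  extDerivForm (fun q w => C.A q w) X Y p + bracket Λ (C.A p (X p)) (C.A p (Y p))

/-- The Cartan geometry is torsion-free: its curvature takes values in `𝔥`. -/
def TorsionFree (C : CartanGeometry Λ m n E M E' P) : Prop :=
  ∀ (p : P) (X Y : Π p : P, TangentSpace 𝓘(ℝ, E') p),
    SmoothFieldAt X p → SmoothFieldAt Y p → projZ (C.curvature X Y p) = 0

/-- The admissible frame `φ(p) : 𝔷 → T_xM` of `TM` at `x = π(p)` given by `p ∈ P`. It maps `z` to
`π_*(w)` for any `w ∈ T_pP` whose `𝔷`-component is `e(w) = z`, such as `w = A_p⁻¹(z)`; see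
`frame_apply`. -/
def frame (C : CartanGeometry Λ m n E M E' P) (p : P) : FrameSpace m n E M :=
  ⟨C.proj p, ((mfderiv 𝓘(ℝ, E') 𝓘(ℝ, E) C.proj p).comp
    ((C.A p).symm : KleinAlgebra m n →L[ℝ] TangentSpace 𝓘(ℝ, E') p)).comp inclZ⟩

lemma proj_surjective (C : CartanGeometry Λ m n E M E' P) (x : M) : ∃ p, C.proj p = x := by
  obtain ⟨U, s, τ, -, hx, -, -, hs, -⟩ := C.locally_trivial x
  exact ⟨s x, hs x hx⟩

lemma curve_smooth (C : CartanGeometry Λ m n E M E' P) (h : OAlgebra m n) (p : P) :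
    ContMDiff 𝓘(ℝ, ℝ) 𝓘(ℝ, E') ∞ (fun t : ℝ => C.act p (expO (t • h))) := by
  have h1 : ContDiff ℝ ∞ (fun u : EuclideanSpace ℝ (Fin 1) => toEnd (expO (u 0 • h))) := by
    have h2 : ContDiff ℝ ∞ (NormedSpace.exp : (Z m n →L[ℝ] Z m n) → _) :=
      contDiff_iff_contDiffAt.2 fun x => (NormedSpace.exp_analytic (𝕂 := ℝ) x).contDiffAt
    have h3 : ContDiff ℝ ∞ (fun u : EuclideanSpace ℝ (Fin 1) =>
        u 0 • valO h) := by fun_prop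
    exact h2.comp h3
  have h4 := C.smooth_act 1 (fun u => expO (u 0 • h)) h1
  have h5 : ContMDiff 𝓘(ℝ, ℝ) (𝓘(ℝ, E').prod 𝓘(ℝ, EuclideanSpace ℝ (Fin 1))) ∞
      (fun t : ℝ => ((p, WithLp.toLp 2 (fun _ => t)) : P × EuclideanSpace ℝ (Fin 1))) := by
    refine contMDiff_const.prodMk (ContDiff.contMDiff ?_)
    fun_prop
  exact h4.comp h5

lemma act_smooth (C : CartanGeometry Λ m n E M E' P) (k : O m n) :
    ContMDiff 𝓘(ℝ, E') 𝓘(ℝ, E') ∞ (fun p => C.act p k) := by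
  have h4 := C.smooth_act 0 (fun _ => k) contDiff_const
  exact h4.comp (contMDiff_id.prodMk (contMDiff_const (c := 0)))

lemma expO_zero (h : OAlgebra m n) : expO ((0 : ℝ) • h) = 1 := by
  apply Subtype.ext
  ext1
  funext z
  change NormedSpace.exp (valO ((0 : ℝ) • h)) z = z
  simp [NormedSpace.exp_zero]

lemma mfderiv_proj_vertical (C : CartanGeometry Λ m n E M E' P) (h : OAlgebra m n) (p : P) :
    mfderiv 𝓘(ℝ, E') 𝓘(ℝ, E) C.proj p ((C.A p).symm (inclH h)) = 0 := by
  have h0 : C.act p (expO ((0 : ℝ) • h)) = p := by rw [expO_zero, C.act_one]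
  have key : ∀ q, q = C.act p (expO ((0 : ℝ) • h)) →
      mfderiv 𝓘(ℝ, E') 𝓘(ℝ, E) C.proj q ((C.A q).symm (inclH h)) = 0 := by
    rintro q rfl
    rw [← C.fundamental h p, ContinuousLinearEquiv.symm_apply_apply]
    have d1 := ((C.curve_smooth h p).mdifferentiable (by simp)) 0
    have d2 := (C.smooth_proj.mdifferentiable (by simp)) (C.act p (expO ((0 : ℝ) • h)))
    have d3 := mfderiv_comp (0 : ℝ) d2 d1
    have d4 : C.proj ∘ (fun t : ℝ => C.act p (expO (t • h))) = fun _ => C.proj p := by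
      funext t; exact C.proj_act _ _
    rw [d4, mfderiv_const] at d3
    exact (DFunLike.congr_fun d3 (1 : ℝ)).symm
  exact key p h0.symm

/-- The admissible frame `φ(p)` maps the `𝔷`-component `e(w)` of `A_p(w)` to `π_*(w)`. -/
lemma frame_apply (C : CartanGeometry Λ m n E M E' P) (p : P) (w : TangentSpace 𝓘(ℝ, E') p) :
    (C.frame p).snd (projZ (C.A p w)) = mfderiv 𝓘(ℝ, E') 𝓘(ℝ, E) C.proj p w := by
  have h1 := inclH_add_inclZ (C.A p w)
  have h2 : w = (C.A p).symm (inclH (projH (C.A p w))) + (C.A p).symm (inclZ (projZ (C.A p w))) := by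
    rw [← map_add, h1, ContinuousLinearEquiv.symm_apply_apply]
  conv_rhs => rw [h2]
  rw [map_add, mfderiv_proj_vertical, zero_add]
  rfl

lemma frame_surjective (C : CartanGeometry Λ m n E M E' P) (p : P) :
    Function.Surjective (C.frame p).snd := by
  intro v
  obtain ⟨U, s, τ, hU, hx, hs, -, hs', hτ, -⟩ := C.locally_trivial (C.proj p)
  have hp : C.act (s (C.proj p)) (τ p) = p := hτ p hx
  have d1 : MDifferentiableAt 𝓘(ℝ, E) 𝓘(ℝ, E') (fun y => C.act (s y) (τ p)) (C.proj p) :=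
    ((C.act_smooth (τ p)).contMDiffAt.comp _
      (hs.contMDiffAt (hU.mem_nhds hx))).mdifferentiableAt (by simp)
  have key : ∀ q, q = C.act (s (C.proj p)) (τ p) → ∀ v : E, ∃ w : TangentSpace 𝓘(ℝ, E') q,
      mfderiv 𝓘(ℝ, E') 𝓘(ℝ, E) C.proj q w = v := by
    rintro q rfl v
    have d2 := (C.smooth_proj.mdifferentiable (by simp)) (C.act (s (C.proj p)) (τ p))
    have d3 := mfderiv_comp (C.proj p) d2 d1
    have d4 : C.proj ∘ (fun y => C.act (s y) (τ p)) =ᶠ[𝓝 (C.proj p)] id := by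
      filter_upwards [hU.mem_nhds hx] with y hy
      exact (C.proj_act _ _).trans (hs' y hy)
    rw [d4.mfderiv_eq, mfderiv_id] at d3
    exact ⟨_, (DFunLike.congr_fun d3 v).symm⟩
  obtain ⟨w, hw⟩ := key p hp.symm v
  exact ⟨(projZ (C.A p w)), (C.frame_apply p w).trans hw⟩

/-- An admissible frame is a linear bijection. -/
lemma frame_bijective [FiniteDimensional ℝ E] (hE : Module.finrank ℝ E = m + n)
    (C : CartanGeometry Λ m n E M E' P) (p : P) : Function.Bijective (C.frame p).snd := by
  refine ⟨?_, C.frame_surjective p⟩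
  have hd : Module.finrank ℝ (Z m n) = Module.finrank ℝ E := by simp [hE]
  have := (LinearMap.injective_iff_surjective_of_finrank_eq_finrank
    (f := ((C.frame p).snd : Z m n →L[ℝ] E).toLinearMap) hd).2 (C.frame_surjective p)
  exact this

/-- `φ(p k) = φ(p) ∘ k`. -/
lemma frame_act (C : CartanGeometry Λ m n E M E' P) (p : P) (k : O m n) (z : Z m n) :
    ((C.frame (C.act p k)).snd : Z m n →L[ℝ] E) z
      = ((C.frame p).snd : Z m n →L[ℝ] E) (toEnd k z) := by
  set w := (C.A p).symm (inclZ (toEnd k z)) with hw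
  have h1 := C.equivariant k p w
  have h2 : projZ (C.A (C.act p k)
      (mfderiv 𝓘(ℝ, E') 𝓘(ℝ, E') (fun q => C.act q k) p w)) = z := by
    rw [h1, hw, ContinuousLinearEquiv.apply_symm_apply, projZ_Ad]
    change toEnd k⁻¹ (toEnd k z) = z
    exact (k : Z m n ≃L[ℝ] Z m n).symm_apply_apply z
  have h3 := C.frame_apply (C.act p k)
    (mfderiv 𝓘(ℝ, E') 𝓘(ℝ, E') (fun q => C.act q k) p w)
  rw [h2] at h3
  have d1 := ((C.act_smooth k).mdifferentiable (by simp)) p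
  have d2 := (C.smooth_proj.mdifferentiable (by simp)) (C.act p k)
  have d3 := mfderiv_comp p d2 d1
  have d4 : C.proj ∘ (fun q => C.act q k) = C.proj := by
    funext q; exact C.proj_act _ _
  rw [d4] at d3
  refine h3.trans ?_
  exact (DFunLike.congr_fun d3 w).symm

lemma exists_act_eq (C : CartanGeometry Λ m n E M E' P) {p q : P} (h : C.proj p = C.proj q) :
    ∃ k, C.act p k = q := by
  obtain ⟨U, s, τ, hU, hx, -, -, -, hτ, -⟩ := C.locally_trivial (C.proj p)
  have h1 := hτ p hx
  have h2 := hτ q (h ▸ hx)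
  rw [← h] at h2
  refine ⟨(τ p)⁻¹ * τ q, ?_⟩
  generalize τ p = a at h1
  rw [← h1, ← C.act_mul, mul_inv_cancel_left, h2]

/-- The metric on `M` associated to the Cartan geometry, `g(v, v') = η(f⁻¹ v, f⁻¹ v')` for the
admissible frame `f = φ(p)` of any `p` over `x`; see `metric_frame` for the independence of `p`. -/
def metric (C : CartanGeometry Λ m n E M E' P) (x : M) (v v' : TangentSpace 𝓘(ℝ, E) x) : ℝ :=
  eta ((C.frame (C.proj_surjective x).choose).snd.inverse v)
    ((C.frame (C.proj_surjective x).choose).snd.inverse v')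

lemma inverse_apply_of_bijective [FiniteDimensional ℝ E] (L : Z m n →L[ℝ] E)
    (hb : Function.Bijective L) (x : Z m n) : L.inverse (L x) = x := by
  let e : Z m n ≃L[ℝ] E := (LinearEquiv.ofBijective L.toLinearMap hb).toContinuousLinearEquiv
  have he : L = e := by ext x; rfl
  rw [he, ContinuousLinearMap.inverse_equiv]
  exact e.symm_apply_apply x

/-- The associated metric is given by `g(f z, f z') = η(z, z')` for every admissible frame `f`. -/
lemma metric_frame [FiniteDimensional ℝ E] (hE : Module.finrank ℝ E = m + n)
    (C : CartanGeometry Λ m n E M E' P) (p : P) (z z' : Z m n) :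
    C.metric (C.proj p) ((C.frame p).snd z) ((C.frame p).snd z') = eta z z' := by
  have hq := (C.proj_surjective (C.proj p)).choose_spec
  unfold metric
  generalize (C.proj_surjective (C.proj p)).choose = q at hq ⊢
  obtain ⟨k, hk⟩ := C.exists_act_eq hq
  have hb : Function.Bijective ((C.frame q).snd : Z m n →L[ℝ] E) := C.frame_bijective hE q
  have key : ∀ x : Z m n, ((C.frame q).snd : Z m n →L[ℝ] E).inverse
      (((C.frame p).snd : Z m n →L[ℝ] E) x) = toEnd k x := by
    intro x
    have h1 := C.frame_act q k x
    rw [hk] at h1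
    rw [h1]
    exact inverse_apply_of_bijective (E := E) _ hb _
  have k1 := key z
  have k2 := key z'
  have k3 : eta (toEnd k z) (toEnd k z') = eta z z' := k.2 z z'
  rw [← k3, ← k1, ← k2]

variable [FiniteDimensional ℝ E] [IsManifold 𝓘(ℝ, E) ∞ M] [FiniteDimensional ℝ E']

/-- The Cartan geometry is invariant under `ξ`: the complete lift of `ξ` is tangent to the bundle
`φ(P)` of admissible frames, and the Cartan connection is invariant under the restriction of the
complete lift. Here the restriction to `φ(P)` and the connection on `φ(P)` are expressed on `P`
through `φ`: `X` is the vector field on `P` whose image under `φ` is the complete lift. -/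
def IsInvariant (C : CartanGeometry Λ m n E M E' P) (ξ : Π x : M, TangentSpace 𝓘(ℝ, E) x) : Prop :=
  ∃ X : Π p : P, TangentSpace 𝓘(ℝ, E') p, SmoothField X ∧
    (∀ p, mfderiv 𝓘(ℝ, E') (frameModel m n E) C.frame p (X p) = completeLift ξ (C.frame p)) ∧
    ∀ (p : P) (Y : Π p : P, TangentSpace 𝓘(ℝ, E') p), SmoothFieldAt Y p →
      lieDerivForm X (fun q w => C.A q w) Y p = 0

end CartanGeometry

end Geometry

end OrthogonalCartan

end

set_option linter.unusedSectionVars false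

noncomputable section

namespace OrthogonalCartan

/-! ### Derivatives along vector fields and their commutators. -/

section Calculus

variable {E : Type*} [NormedAddCommGroup E] [NormedSpace ℝ E]
  {M : Type*} [TopologicalSpace M] [ChartedSpace E M] [IsManifold 𝓘(ℝ, E) ∞ M]
  {F : Type*} [NormedAddCommGroup F] [NormedSpace ℝ F]

/-! The connection trivialises `TP`, and a vector field `Y` on `M` becomes the 𝔷-valued function
`C.hat Y` on `P` of its components in the admissible frames, with `g(Y, W) = η(hat Y, hat W)`. Both
sides of the equivalence are thereby statements about derivatives of functions on `P`.

If the geometry is invariant, the base component of the complete lift shows that `X` projects to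
`ξ`. The 𝔷-part of `L_X A = 0`, evaluated on the horizontal lift of `Y`, reads `X(hat Y) = hat [ξ,
Y]`, and `lieDerivMetric_eq` then gives `L_ξ g = 0`.

Conversely, let `ξ` be Killing. Differentiating `hat ξ` along horizontal directions gives the
covariant derivative `C.covDeriv ξ`. Vanishing torsion turns the Killing equation into its skewness
(`covDeriv_mem_o`), so it is 𝔥-valued and there is a field `X` on `P` with `e(X) = hat ξ` and `ω(X)
= covDeriv ξ` (`exists_killingLift`). The structure equation then says that `X` preserves `e`
(`solder_mlieBracket_killingLift`).

That `X` preserves `ω` as well is the uniqueness of the Levi-Civita connection in infinitesimal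
form. The bracket of `X` with a field on which `A` is constant has no `e`-part; by the Jacobi
identity its `ω`-part, as a function of the constant in 𝔷, is a symmetric bilinear map with values
in skew endomorphisms, hence zero (`eq_zero_of_symm_of_skew`). So `X` commutes with all constant
fields, which yields `L_X A = 0`. It also yields that `φ` maps `X` to the complete lift: the columns
of a frame are derivatives of chart functions along constant fields, and `X` may be moved past these
(`mfderiv_frame_eq_completeLift`). -/

lemma dirDeriv_contMDiffAt {X : Π x : M, TangentSpace 𝓘(ℝ, E) x} {u : M → F} {x : M}
    (hX : SmoothFieldAt X x) (hu : ContMDiffAt 𝓘(ℝ, E) 𝓘(ℝ, F) ∞ u x) :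
    ContMDiffAt 𝓘(ℝ, E) 𝓘(ℝ, F) ∞ (dirDeriv X u) x := by
  have h1 := hu.mfderiv_const (m := ∞) (by simp)
  have h2 := ContMDiffAt.clm_apply_of_inCoordinates (n := ∞) (IB₁ := 𝓘(ℝ, E)) (IB₂ := 𝓘(ℝ, F))
    (b₁ := id) (b₂ := u) (m₀ := x) (F₁ := E) (F₂ := F)
    (E₁ := fun y : M => TangentSpace 𝓘(ℝ, E) y) (E₂ := fun y : F => TangentSpace 𝓘(ℝ, F) y)
    (ϕ := fun y => mfderiv 𝓘(ℝ, E) 𝓘(ℝ, F) u y) (v := X) (IM := 𝓘(ℝ, E)) h1 hX hu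
  exact (contMDiff_snd_tangentBundle_modelSpace F 𝓘(ℝ, F)).contMDiffAt.comp x h2

lemma dirDeriv_congr_of_eventuallyEq {X : Π x : M, TangentSpace 𝓘(ℝ, E) x} {u v : M → F} {x : M}
    (h : u =ᶠ[𝓝 x] v) : dirDeriv X u x = dirDeriv X v x := by
  unfold dirDeriv; rw [h.mfderiv_eq]; rfl

lemma dirDeriv_const {X : Π x : M, TangentSpace 𝓘(ℝ, E) x} (c : F) (x : M) :
    dirDeriv X (fun _ => c) x = 0 := by
  unfold dirDeriv; rw [mfderiv_const]; rfl

lemma dirDeriv_comp {F' : Type*} [NormedAddCommGroup F'] [NormedSpace ℝ F']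
    {X : Π x : M, TangentSpace 𝓘(ℝ, E) x} {u : M → F} {g : F → F'} {x : M}
    (hg : DifferentiableAt ℝ g (u x)) (hu : MDifferentiableAt 𝓘(ℝ, E) 𝓘(ℝ, F) u x) :
    dirDeriv X (fun y => g (u y)) x = fderiv ℝ g (u x) (dirDeriv X u x) := by
  unfold dirDeriv
  have := mfderiv_comp x hg.mdifferentiableAt hu
  rw [mfderiv_eq_fderiv] at this
  exact DFunLike.congr_fun this (X x)

/-- The derivative of `u` along `X` in the chart at `x`. -/
lemma dirDeriv_chart {X : Π x : M, TangentSpace 𝓘(ℝ, E) x} {u : M → F} {x : M}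
    (hu : ContMDiffAt 𝓘(ℝ, E) 𝓘(ℝ, F) 1 u x) :
    ∀ᶠ y in 𝓝 (extChartAt 𝓘(ℝ, E) x x),
      dirDeriv X u ((extChartAt 𝓘(ℝ, E) x).symm y) =
       fderiv ℝ (u ∘ (extChartAt 𝓘(ℝ, E) x).symm) y
        (mpullback 𝓘(ℝ, E) 𝓘(ℝ, E) (extChartAt 𝓘(ℝ, E) x).symm X y) := by
  have h1 : ∀ᶠ z in 𝓝 x, ContMDiffAt 𝓘(ℝ, E) 𝓘(ℝ, F) 1 u z :=
    (contMDiffAt_iff_contMDiffAt_nhds (by simp)).1 hu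
  have h2 : Filter.Tendsto (extChartAt 𝓘(ℝ, E) x).symm (𝓝 (extChartAt 𝓘(ℝ, E) x x)) (𝓝 x) := by
    have := (continuousAt_extChartAt_symm (I := 𝓘(ℝ, E)) x)
    simpa [ContinuousAt] using this
  filter_upwards [h2.eventually h1,
    (isOpen_extChartAt_target (I := 𝓘(ℝ, E)) x).mem_nhds (mem_extChartAt_target x)] with y hy hy'
  have h3 := isInvertible_mfderivWithin_extChartAt_symm hy'
  have h4 := mdifferentiableWithinAt_extChartAt_symm hy'
  simp only [modelWithCornersSelf_coe, range_id, mfderivWithin_univ,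
    mdifferentiableWithinAt_univ] at h3 h4
  have h5 := mfderiv_comp y (hy.mdifferentiableAt one_ne_zero) h4
  rw [mfderiv_eq_fderiv] at h5
  unfold dirDeriv
  refine Eq.trans ?_ (DFunLike.congr_fun h5 _).symm
  refine congrArg (mfderiv 𝓘(ℝ, E) 𝓘(ℝ, F) u ((extChartAt 𝓘(ℝ, E) x).symm y)) ?_
  exact (h3.self_apply_inverse _).symm

/-- The second-order terms in `U` cancel by symmetry of the second derivative; only derivatives of
`V` and `W` remain. -/
lemma fderiv_lieBracket {U : E → F} {V W : E → E} {y : E} (hU : ContDiffAt ℝ 2 U y)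
    (hV : DifferentiableAt ℝ V y) (hW : DifferentiableAt ℝ W y) :
    fderiv ℝ U y (lieBracket ℝ V W y) =
      fderiv ℝ (fun z => fderiv ℝ U z (W z)) y (V y)
        - fderiv ℝ (fun z => fderiv ℝ U z (V z)) y (W y) := by
  have h1 : DifferentiableAt ℝ (fderiv ℝ U) y :=
    (hU.fderiv_right (m := 1) (by norm_num)).differentiableAt (by simp)
  have h2 : IsSymmSndFDerivAt ℝ U y := hU.isSymmSndFDerivAt (by simp)
  rw [fderiv_clm_apply h1 hW, fderiv_clm_apply h1 hV, lieBracket]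
  simp [h2.eq (V y) (W y)]

/-- Transports `fderiv_lieBracket` through the chart at `x`. Applied to charts as vector-valued
functions, it lets brackets be computed by commuting derivatives. -/
lemma dirDeriv_mlieBracket [CompleteSpace E] {V W : Π x : M, TangentSpace 𝓘(ℝ, E) x} {u : M → F}
    {x : M} (hV : SmoothFieldAt V x) (hW : SmoothFieldAt W x)
    (hu : ContMDiffAt 𝓘(ℝ, E) 𝓘(ℝ, F) ∞ u x) :
    dirDeriv (mlieBracket 𝓘(ℝ, E) V W) u x =
      dirDeriv V (dirDeriv W u) x - dirDeriv W (dirDeriv V u) x := by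
  set φ := extChartAt 𝓘(ℝ, E) x with hφ
  set V' : E → E := mpullback 𝓘(ℝ, E) 𝓘(ℝ, E) φ.symm V with hV'
  set W' : E → E := mpullback 𝓘(ℝ, E) 𝓘(ℝ, E) φ.symm W with hW'
  have e0 : φ.symm (φ x) = x := extChartAt_to_inv x
  have diff : ∀ {V : Π x : M, TangentSpace 𝓘(ℝ, E) x}, SmoothFieldAt V x →
      DifferentiableAt ℝ (mpullback 𝓘(ℝ, E) 𝓘(ℝ, E) φ.symm V : E → E) (φ x) := by
    intro V hV
    have h1 := (hV.mdifferentiableAt (by simp)).mdifferentiableWithinAt (s := univ)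
    have h2 := h1.differentiableWithinAt_mpullbackWithin_vectorField
    simp only [modelWithCornersSelf_coe, range_id, preimage_univ, inter_univ,
      mpullbackWithin_univ] at h2
    exact differentiableWithinAt_univ.1 h2
  have eval : ∀ (V : Π x : M, TangentSpace 𝓘(ℝ, E) x) {u : M → F},
      ContMDiffAt 𝓘(ℝ, E) 𝓘(ℝ, F) 1 u x →
      dirDeriv V u x = fderiv ℝ (u ∘ φ.symm) (φ x) (mpullback 𝓘(ℝ, E) 𝓘(ℝ, E) φ.symm V (φ x)) := by
    intro V u hu
    have h := (dirDeriv_chart (X := V) hu).self_of_nhds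
    rwa [e0] at h
  have hu1 : ContMDiffAt 𝓘(ℝ, E) 𝓘(ℝ, F) 1 u x := hu.of_le (by simp)
  let LB : E := lieBracket ℝ V' W' (φ x)
  -- The manifold bracket at `x` is by definition the chart bracket pulled back by `φ`; pulling it
  -- back again by `φ.symm` undoes this. The comparison is made after applying the injective inverse
  -- of `dφ`.
  have br : mpullback 𝓘(ℝ, E) 𝓘(ℝ, E) φ.symm (mlieBracket 𝓘(ℝ, E) V W) (φ x)
      = lieBracket ℝ V' W' (φ x) := by
    have h1 : mlieBracket 𝓘(ℝ, E) V W x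
        = (mfderiv 𝓘(ℝ, E) 𝓘(ℝ, E) φ x).inverse LB := by
      have h := mlieBracketWithin_apply (I := 𝓘(ℝ, E)) (V := V) (W := W) (s := univ) (x₀ := x)
      simp only [modelWithCornersSelf_coe, range_id, preimage_univ, inter_univ,
        mpullbackWithin_univ, mlieBracketWithin_univ] at h
      have h' : lieBracketWithin ℝ V' W' univ (φ x) = LB := congrFun lieBracketWithin_univ _
      rw [← h']
      exact h
    have h2 := mfderiv_extChartAt_inverse_comp_mfderivWithin_extChartAT_symm (I := 𝓘(ℝ, E))
      (mlieBracket 𝓘(ℝ, E) V W x)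
    simp only [modelWithCornersSelf_coe, range_id, mfderivWithin_univ] at h2
    -- All tangent spaces are `E` by definition, so the base point `φ.symm (φ x)` can be replaced by
    -- `x` inside `E`.
    have h3 : ∀ z, z = x → ((mlieBracket 𝓘(ℝ, E) V W z : E) = mlieBracket 𝓘(ℝ, E) V W x) := by
      rintro z rfl; rfl
    have h4 := (isInvertible_mfderiv_extChartAt (I := 𝓘(ℝ, E))
      (mem_extChartAt_source (I := 𝓘(ℝ, E)) x)).inverse
    have h5 : Function.Injective (mfderiv 𝓘(ℝ, E) 𝓘(ℝ, E) φ x).inverse := h4.injective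
    apply h5
    refine Eq.trans ?_ (h2.trans h1)
    exact congrArg (fun v : E => (mfderiv 𝓘(ℝ, E) 𝓘(ℝ, E) φ x).inverse
      ((mfderiv 𝓘(ℝ, E) 𝓘(ℝ, E) φ.symm (φ x)).inverse v)) (h3 _ e0)
  have second : ∀ (V : Π x : M, TangentSpace 𝓘(ℝ, E) x),
      ((dirDeriv V u) ∘ φ.symm) =ᶠ[𝓝 (φ x)] fun y =>
        fderiv ℝ (u ∘ φ.symm) y (mpullback 𝓘(ℝ, E) 𝓘(ℝ, E) φ.symm V y) :=
    fun V => dirDeriv_chart (X := V) hu1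
  have hU : ContDiffAt ℝ 2 (u ∘ φ.symm) (φ x) := by
    have h1 := hu.comp_of_eq (contMDiffOn_extChartAt_symm (I := 𝓘(ℝ, E)) (n := ∞) x |>.contMDiffAt
      (extChartAt_target_mem_nhds x)) e0
    exact h1.contDiffAt.of_le (ENat.LEInfty.out)
  rw [eval _ hu1, eval V ((dirDeriv_contMDiffAt hW hu).of_le (by simp)),
    eval W ((dirDeriv_contMDiffAt hV hu).of_le (by simp)), br,
    (second V).fderiv_eq, (second W).fderiv_eq]
  exact fderiv_lieBracket hU (diff hV) (diff hW)

end Calculus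

/-! ### Related vector fields, brackets, and product rules. -/

section Calculus

variable {E : Type*} [NormedAddCommGroup E] [NormedSpace ℝ E]
  {M : Type*} [TopologicalSpace M] [ChartedSpace E M] [IsManifold 𝓘(ℝ, E) ∞ M]
  {E' : Type*} [NormedAddCommGroup E'] [NormedSpace ℝ E']
  {P : Type*} [TopologicalSpace P] [ChartedSpace E' P] [IsManifold 𝓘(ℝ, E') ∞ P]
  {F : Type*} [NormedAddCommGroup F] [NormedSpace ℝ F]

lemma dirDeriv_comp_of_related {ρ : P → M} {V : Π p : P, TangentSpace 𝓘(ℝ, E') p}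
    {v : Π x : M, TangentSpace 𝓘(ℝ, E) x} {u : M → F} {p : P}
    (hρ : MDifferentiableAt 𝓘(ℝ, E') 𝓘(ℝ, E) ρ p)
    (hu : MDifferentiableAt 𝓘(ℝ, E) 𝓘(ℝ, F) u (ρ p))
    (h : mfderiv 𝓘(ℝ, E') 𝓘(ℝ, E) ρ p (V p) = v (ρ p)) :
    dirDeriv V (fun q => u (ρ q)) p = dirDeriv v u (ρ p) := by
  unfold dirDeriv
  rw [← h]
  exact DFunLike.congr_fun (mfderiv_comp p hu hρ) (V p)

lemma dirDeriv_comp_related_eventuallyEq {ρ : P → M} {V : Π p : P, TangentSpace 𝓘(ℝ, E') p}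
    {v : Π x : M, TangentSpace 𝓘(ℝ, E) x} {u : M → F} {p : P}
    (hρ : ContMDiff 𝓘(ℝ, E') 𝓘(ℝ, E) ∞ ρ)
    (hu : ContMDiffAt 𝓘(ℝ, E) 𝓘(ℝ, F) ∞ u (ρ p))
    (h : ∀ q, mfderiv 𝓘(ℝ, E') 𝓘(ℝ, E) ρ q (V q) = v (ρ q)) :
    dirDeriv V (fun q => u (ρ q)) =ᶠ[𝓝 p] fun q => dirDeriv v u (ρ q) := by
  have h1 : ∀ᶠ y in 𝓝 (ρ p), ContMDiffAt 𝓘(ℝ, E) 𝓘(ℝ, F) 1 u y :=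
    (contMDiffAt_iff_contMDiffAt_nhds (by simp)).1 (hu.of_le (by simp))
  filter_upwards [hρ.continuous.continuousAt.eventually h1] with q hq
  exact dirDeriv_comp_of_related (hρ.mdifferentiable (by simp) q)
    (hq.mdifferentiableAt one_ne_zero) (h q)

/-- The brackets of vector fields related by a smooth map are related. -/
lemma mfderiv_mlieBracket_of_related [CompleteSpace E] [CompleteSpace E'] {ρ : P → M}
    {V W : Π p : P, TangentSpace 𝓘(ℝ, E') p} {v w : Π x : M, TangentSpace 𝓘(ℝ, E) x} {p : P}
    (hρ : ContMDiff 𝓘(ℝ, E') 𝓘(ℝ, E) ∞ ρ)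
    (hV : SmoothFieldAt V p) (hW : SmoothFieldAt W p)
    (hv : SmoothFieldAt v (ρ p)) (hw : SmoothFieldAt w (ρ p))
    (hVv : ∀ q, mfderiv 𝓘(ℝ, E') 𝓘(ℝ, E) ρ q (V q) = v (ρ q))
    (hWw : ∀ q, mfderiv 𝓘(ℝ, E') 𝓘(ℝ, E) ρ q (W q) = w (ρ q)) :
    mfderiv 𝓘(ℝ, E') 𝓘(ℝ, E) ρ p (mlieBracket 𝓘(ℝ, E') V W p)
      = mlieBracket 𝓘(ℝ, E) v w (ρ p) := by
  -- The differential of a chart is injective, so equality of tangent vectors can be tested on this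
  -- one vector-valued function.
  set u : M → E := ⇑(extChartAt 𝓘(ℝ, E) (ρ p)) with hu_def
  have hu : ContMDiffAt 𝓘(ℝ, E) 𝓘(ℝ, E) ∞ u (ρ p) := contMDiffAt_extChartAt
  have hρd : MDifferentiableAt 𝓘(ℝ, E') 𝓘(ℝ, E) ρ p := hρ.mdifferentiable (by simp) p
  have hinj : Function.Injective (mfderiv 𝓘(ℝ, E) 𝓘(ℝ, E) u (ρ p)) :=
    (isInvertible_mfderiv_extChartAt (I := 𝓘(ℝ, E))
      (mem_extChartAt_source (I := 𝓘(ℝ, E)) (ρ p))).injective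
  apply hinj
  have k1 := dirDeriv_mlieBracket hV hW (hu.comp p hρ.contMDiffAt)
  have k2 := dirDeriv_mlieBracket hv hw hu
  have e1 : dirDeriv (mlieBracket 𝓘(ℝ, E') V W) (u ∘ ρ) p
      = mfderiv 𝓘(ℝ, E) 𝓘(ℝ, E) u (ρ p)
        (mfderiv 𝓘(ℝ, E') 𝓘(ℝ, E) ρ p (mlieBracket 𝓘(ℝ, E') V W p)) :=
    DFunLike.congr_fun (mfderiv_comp p (hu.mdifferentiableAt (by simp)) hρd) _
  refine e1.symm.trans (k1.trans (Eq.trans ?_ k2.symm))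
  congr 1
  · rw [dirDeriv_congr_of_eventuallyEq (u := dirDeriv W (u ∘ ρ))
      (dirDeriv_comp_related_eventuallyEq (ρ := ρ) hρ hu hWw)]
    exact dirDeriv_comp_of_related hρd
      ((dirDeriv_contMDiffAt hw hu).mdifferentiableAt (by simp)) (hVv p)
  · rw [dirDeriv_congr_of_eventuallyEq (u := dirDeriv V (u ∘ ρ))
      (dirDeriv_comp_related_eventuallyEq (ρ := ρ) hρ hu hVv)]
    exact dirDeriv_comp_of_related hρd
      ((dirDeriv_contMDiffAt hv hu).mdifferentiableAt (by simp)) (hWw p)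

lemma SmoothFieldAt.mlieBracket [CompleteSpace E] {V W : Π x : M, TangentSpace 𝓘(ℝ, E) x} {x : M}
    (hV : SmoothFieldAt V x) (hW : SmoothFieldAt W x) :
    SmoothFieldAt (mlieBracket 𝓘(ℝ, E) V W) x := by
  have : IsManifold 𝓘(ℝ, E) (minSmoothness ℝ 2) M := by
    rw [minSmoothness_of_isRCLikeNormedField]; infer_instance
  have : IsManifold 𝓘(ℝ, E) (((⊤ : ℕ∞) : WithTop ℕ∞) + 1) M :=
    inferInstanceAs (IsManifold 𝓘(ℝ, E) ∞ M)
  exact ContMDiffAt.mlieBracket_vectorField (n := ⊤) (m := ⊤) hV hW (by simp)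

lemma mlieBracket_jacobi [CompleteSpace E] {U V W : Π x : M, TangentSpace 𝓘(ℝ, E) x} {x : M}
    (hU : SmoothFieldAt U x) (hV : SmoothFieldAt V x) (hW : SmoothFieldAt W x) :
    mlieBracket 𝓘(ℝ, E) U (mlieBracket 𝓘(ℝ, E) V W) x =
      mlieBracket 𝓘(ℝ, E) (mlieBracket 𝓘(ℝ, E) U V) W x
        + mlieBracket 𝓘(ℝ, E) V (mlieBracket 𝓘(ℝ, E) U W) x := by
  have : IsManifold 𝓘(ℝ, E) (minSmoothness ℝ 3) M := by
    rw [minSmoothness_of_isRCLikeNormedField]; infer_instance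
  have h2 : minSmoothness ℝ 2 ≤ ∞ := by
    rw [minSmoothness_of_isRCLikeNormedField]; exact ENat.LEInfty.out
  exact leibniz_identity_mlieBracket_apply (hU.of_le h2) (hV.of_le h2) (hW.of_le h2)

/-- A function valued in continuous linear maps on a finite-dimensional space is smooth if all its
evaluations are. -/
lemma contMDiffAt_clm_of_apply {G : Type*} [NormedAddCommGroup G] [NormedSpace ℝ G]
    [FiniteDimensional ℝ G] {f : M → G →L[ℝ] F} {x : M}
    (h : ∀ z, ContMDiffAt 𝓘(ℝ, E) 𝓘(ℝ, F) ∞ (fun y => f y z) x) :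
    ContMDiffAt 𝓘(ℝ, E) 𝓘(ℝ, G →L[ℝ] F) ∞ f x := by
  let b := Module.finBasis ℝ G
  let L : ∀ i, F →L[ℝ] (G →L[ℝ] F) := fun i =>
    ContinuousLinearMap.smulRightL ℝ G F (LinearMap.toContinuousLinearMap (b.coord i))
  have e : f = fun y => ∑ i, L i (f y (b i)) := by
    funext y
    ext z
    have h1 := congrArg (f y) (b.sum_repr z)
    simp only [map_sum, map_smul] at h1
    simpa [L] using h1.symm
  rw [e]
  exact contMDiffAt_finsetSum fun i _ => (L i).contMDiff.contMDiffAt.comp x (h (b i))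

lemma dirDeriv_clm {F' : Type*} [NormedAddCommGroup F'] [NormedSpace ℝ F'] (L : F →L[ℝ] F')
    {X : Π x : M, TangentSpace 𝓘(ℝ, E) x} {u : M → F} {x : M}
    (hu : MDifferentiableAt 𝓘(ℝ, E) 𝓘(ℝ, F) u x) :
    dirDeriv X (fun y => L (u y)) x = L (dirDeriv X u x) := by
  rw [dirDeriv_comp L.differentiableAt hu, L.fderiv]

/-- `η` as a continuous bilinear form. -/
def etaL {m n : ℕ} : Z m n →L[ℝ] Z m n →L[ℝ] ℝ :=
  LinearMap.toContinuousLinearMap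
    { toFun := fun z => etaLeft z
      map_add' := fun z z' => by ext w; exact eta_add_right w z z'
      map_smul' := fun c z => by ext w; exact eta_smul_right c w z }

lemma etaL_apply {m n : ℕ} (z w : Z m n) : etaL z w = eta z w := eta_comm w z

lemma contMDiffAt_eta {m n : ℕ} {u v : M → Z m n} {x : M}
    (hu : ContMDiffAt 𝓘(ℝ, E) 𝓘(ℝ, Z m n) ∞ u x)
    (hv : ContMDiffAt 𝓘(ℝ, E) 𝓘(ℝ, Z m n) ∞ v x) :
    ContMDiffAt 𝓘(ℝ, E) 𝓘(ℝ, ℝ) ∞ (fun y => eta (u y) (v y)) x := by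
  simp only [← etaL_apply]
  exact (etaL.contMDiff.contMDiffAt.comp x hu).clm_apply hv

lemma dirDeriv_bilinear {F₁ F₂ : Type*} [NormedAddCommGroup F₁] [NormedSpace ℝ F₁]
    [NormedAddCommGroup F₂] [NormedSpace ℝ F₂] (B : F₁ →L[ℝ] F₂ →L[ℝ] F)
    {X : Π x : M, TangentSpace 𝓘(ℝ, E) x} {u : M → F₁} {v : M → F₂} {x : M}
    (hu : MDifferentiableAt 𝓘(ℝ, E) 𝓘(ℝ, F₁) u x)
    (hv : MDifferentiableAt 𝓘(ℝ, E) 𝓘(ℝ, F₂) v x) :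
    dirDeriv X (fun y => B (u y) (v y)) x
      = B (dirDeriv X u x) (v x) + B (u x) (dirDeriv X v x) := by
  have hp : MDifferentiableAt 𝓘(ℝ, E) 𝓘(ℝ, F₁ × F₂) (fun y => (u y, v y)) x :=
    hu.prodMk_space hv
  have hb : HasFDerivAt (fun q : F₁ × F₂ => B q.1 q.2) (B.deriv₂ (u x, v x)) (u x, v x) :=
    B.isBoundedBilinearMap.hasFDerivAt (u x, v x)
  have h := dirDeriv_comp (X := X) (g := fun q : F₁ × F₂ => B q.1 q.2)
    (u := fun y => (u y, v y)) hb.differentiableAt hp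
  have e : dirDeriv X (fun y => (u y, v y)) x = (dirDeriv X u x, dirDeriv X v x) :=
    Prod.ext (dirDeriv_clm (ContinuousLinearMap.fst ℝ F₁ F₂) hp).symm
      (dirDeriv_clm (ContinuousLinearMap.snd ℝ F₁ F₂) hp).symm
  rw [hb.fderiv, e] at h
  rw [h, ContinuousLinearMap.coe_deriv₂, add_comm]

lemma dirDeriv_eta {m n : ℕ} {X : Π x : M, TangentSpace 𝓘(ℝ, E) x} {u v : M → Z m n} {x : M}
    (hu : MDifferentiableAt 𝓘(ℝ, E) 𝓘(ℝ, Z m n) u x)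
    (hv : MDifferentiableAt 𝓘(ℝ, E) 𝓘(ℝ, Z m n) v x) :
    dirDeriv X (fun y => eta (u y) (v y)) x
      = eta (dirDeriv X u x) (v x) + eta (u x) (dirDeriv X v x) := by
  simp only [← etaL_apply]
  exact dirDeriv_bilinear etaL hu hv

/-- Serves to expand an arbitrary field on `P` in the constant fields, with function coefficients.
-/
lemma mlieBracket_sum_smul_right [CompleteSpace E] {ι : Type*} (s : Finset ι)
    {X : Π x : M, TangentSpace 𝓘(ℝ, E) x} {c : ι → M → ℝ} {Y : ι → Π x : M, TangentSpace 𝓘(ℝ, E) x}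
    {x : M} (hc : ∀ i, ContMDiffAt 𝓘(ℝ, E) 𝓘(ℝ, ℝ) ∞ (c i) x) (hY : ∀ i, SmoothFieldAt (Y i) x) :
    mlieBracket 𝓘(ℝ, E) X (∑ i ∈ s, c i • Y i) x
      = ∑ i ∈ s, (dirDeriv X (c i) x • Y i x + c i x • mlieBracket 𝓘(ℝ, E) X (Y i) x) := by
  classical
  induction s using Finset.induction_on with
  | empty =>
    simp only [Finset.sum_empty]
    rw [mlieBracket_zero_right]; rfl
  | insert i s hi ih =>
    have h1 : ∀ i, MDifferentiableAt 𝓘(ℝ, E) 𝓘(ℝ, E).tangent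
        (fun y => (⟨y, (c i • Y i) y⟩ : TangentBundle 𝓘(ℝ, E) M)) x := fun i =>
      ((hc i).mdifferentiableAt (by simp)).smul_section ((hY i).mdifferentiableAt (by simp))
    have h2 : MDifferentiableAt 𝓘(ℝ, E) 𝓘(ℝ, E).tangent
        (fun y => (⟨y, (∑ i ∈ s, c i • Y i) y⟩ : TangentBundle 𝓘(ℝ, E) M)) x := by
      simp only [Finset.sum_apply]
      exact MDifferentiableAt.sum_section fun i _ => h1 i
    rw [Finset.sum_insert hi, Finset.sum_insert hi, mlieBracket_add_right (h1 i) h2, ih,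
      mlieBracket_smul_right ((hc i).mdifferentiableAt (by simp))
        ((hY i).mdifferentiableAt (by simp))]
    rfl

end Calculus

/-! ### Smooth dependence of solutions of linear equations. -/

section Calculus

variable {E : Type*} [NormedAddCommGroup E] [NormedSpace ℝ E]
  {M : Type*} [TopologicalSpace M] [ChartedSpace E M] [IsManifold 𝓘(ℝ, E) ∞ M]
  {F : Type*} [NormedAddCommGroup F] [NormedSpace ℝ F]

/-- The solution of a smooth family of invertible linear equations is smooth. -/
lemma contMDiffAt_of_clm_apply_eq {G : Type*} [NormedAddCommGroup G] [NormedSpace ℝ G]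
    [CompleteSpace G] {L : M → G →L[ℝ] F} {c : M → F} {s : M → G} {x : M}
    (hL : ContMDiffAt 𝓘(ℝ, E) 𝓘(ℝ, G →L[ℝ] F) ∞ L x) (h0 : (L x).IsInvertible)
    (hc : ContMDiffAt 𝓘(ℝ, E) 𝓘(ℝ, F) ∞ c x) (h : ∀ᶠ y in 𝓝 x, L y (s y) = c y) :
    ContMDiffAt 𝓘(ℝ, E) 𝓘(ℝ, G) ∞ s x := by
  obtain ⟨e, he⟩ := h0
  have h1 : ContMDiffAt 𝓘(ℝ, E) 𝓘(ℝ, F →L[ℝ] G) ∞ (fun y => (L y).inverse) x := by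
    have h2 : ContDiffAt ℝ ∞ (ContinuousLinearMap.inverse (R := ℝ) (M := G) (M₂ := F)) (L x) := by
      rw [← he]; exact contDiffAt_map_inverse e
    exact h2.contMDiffAt.comp x hL
  -- Invertible maps form an open set, so invertibility at `x` persists nearby.
  have h3 : ∀ᶠ y in 𝓝 x, L y ∈ Set.range ((↑) : (G ≃L[ℝ] F) → G →L[ℝ] F) :=
    hL.continuousAt.eventually (ContinuousLinearEquiv.isOpen.mem_nhds ⟨e, he⟩)
  refine (h1.clm_apply hc).congr_of_eventuallyEq ?_
  filter_upwards [h, h3] with y hy hy'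
  obtain ⟨e', he'⟩ := hy'
  rw [← hy, ← he', ContinuousLinearMap.inverse_equiv]
  simp

end Calculus

/-! ### Constant fields and components in admissible frames. -/

namespace CartanGeometry

variable {Λ : SignType} {m n : ℕ}
  {E : Type*} [NormedAddCommGroup E] [NormedSpace ℝ E]
  {M : Type*} [TopologicalSpace M] [ChartedSpace E M]
  {E' : Type*} [NormedAddCommGroup E'] [NormedSpace ℝ E']
  {P : Type*} [TopologicalSpace P] [ChartedSpace E' P] [IsManifold 𝓘(ℝ, E') ∞ P]

lemma contMDiffAt_A_apply (C : CartanGeometry Λ m n E M E' P) {V : Π p : P, TangentSpace 𝓘(ℝ, E') p}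
    {p : P} (hV : SmoothFieldAt V p) :
    ContMDiffAt 𝓘(ℝ, E') 𝓘(ℝ, KleinAlgebra m n) ∞ (fun q => C.A q (V q)) p := by
  have h := ContMDiffAt.clm_bundle_apply (C.smooth_A p) hV
  exact (contMDiffAt_totalSpace.1 h).2

/-- In a local trivialisation of `TP` the connection is a smooth family of invertible linear maps,
and the field solves the corresponding linear equation. -/
lemma smoothFieldAt_A_symm [CompleteSpace E'] (C : CartanGeometry Λ m n E M E' P)
    {c : P → KleinAlgebra m n} {p : P}
    (hc : ContMDiffAt 𝓘(ℝ, E') 𝓘(ℝ, KleinAlgebra m n) ∞ c p) :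
    SmoothFieldAt (fun q => (C.A q).symm (c q)) p := by
  have h1 := ((contMDiffAt_hom_bundle _).1 (C.smooth_A p)).2
  refine (contMDiffAt_section _).2 ?_
  have hbase : ∀ᶠ q in 𝓝 p, q ∈ (trivializationAt E' (TangentSpace 𝓘(ℝ, E')) p).baseSet :=
    (trivializationAt E' (TangentSpace 𝓘(ℝ, E')) p).open_baseSet.mem_nhds
      (FiberBundle.mem_baseSet_trivializationAt' p)
  refine contMDiffAt_of_clm_apply_eq h1 ?_ hc ?_
  · rw [ContinuousLinearMap.inCoordinates_eq hbase.self_of_nhds (mem_univ _)]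
    exact ⟨((((trivializationAt E' (TangentSpace 𝓘(ℝ, E')) p).continuousLinearEquivAt ℝ p
      hbase.self_of_nhds).symm).trans (C.A p)).trans
      ((trivializationAt (KleinAlgebra m n) (Trivial P (KleinAlgebra m n)) p
        ).continuousLinearEquivAt
        ℝ p (mem_univ _)), rfl⟩
  · filter_upwards [hbase] with q hq
    rw [ContinuousLinearMap.inCoordinates_eq hq (mem_univ _)]
    refine (congrArg (C.A q) ?_).trans ((C.A q).apply_symm_apply (c q))
    exact Trivialization.symm_apply_apply_mk _ hq _

/-- The vector field on `P` on which the Cartan connection is constant. -/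
def constField (C : CartanGeometry Λ m n E M E' P) (a : KleinAlgebra m n) (p : P) :
    TangentSpace 𝓘(ℝ, E') p :=
  (C.A p).symm a

lemma A_constField (C : CartanGeometry Λ m n E M E' P) (a : KleinAlgebra m n) (p : P) :
    C.A p (C.constField a p) = a :=
  (C.A p).apply_symm_apply a

lemma smoothFieldAt_constField [CompleteSpace E'] (C : CartanGeometry Λ m n E M E' P)
    (a : KleinAlgebra m n) (p : P) : SmoothFieldAt (C.constField a) p :=
  C.smoothFieldAt_A_symm contMDiffAt_const

lemma mdifferentiableAt_proj (C : CartanGeometry Λ m n E M E' P) (p : P) :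
    MDifferentiableAt 𝓘(ℝ, E') 𝓘(ℝ, E) C.proj p :=
  C.smooth_proj.mdifferentiable (by simp) p

lemma mfderiv_proj_A_symm (C : CartanGeometry Λ m n E M E' P) (a : KleinAlgebra m n) (p : P) :
    mfderiv 𝓘(ℝ, E') 𝓘(ℝ, E) C.proj p ((C.A p).symm a) = (C.frame p).snd (projZ a) := by
  rw [← frame_apply, ContinuousLinearEquiv.apply_symm_apply]

/-- The components of a vector field on `M` in the admissible frames. -/
def hat (C : CartanGeometry Λ m n E M E' P) (Y : Π x : M, TangentSpace 𝓘(ℝ, E) x) (p : P) : Z m n :=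
  ((C.frame p).snd : Z m n →L[ℝ] E).inverse (Y (C.proj p))

section

variable [FiniteDimensional ℝ E] (hE : Module.finrank ℝ E = m + n)
include hE

lemma frame_injective (C : CartanGeometry Λ m n E M E' P) (p : P) :
    Function.Injective (C.frame p).snd :=
  (C.frame_bijective hE p).1

lemma frame_isInvertible (C : CartanGeometry Λ m n E M E' P) (p : P) :
    ((C.frame p).snd : Z m n →L[ℝ] E).IsInvertible :=
  let e : Z m n ≃ₗ[ℝ] E := LinearEquiv.ofBijective ((C.frame p).snd : Z m n →L[ℝ] E).toLinearMap
    (C.frame_bijective hE p)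
  ⟨e.toContinuousLinearEquiv, rfl⟩

lemma frame_hat (C : CartanGeometry Λ m n E M E' P) (Y : Π x : M, TangentSpace 𝓘(ℝ, E) x) (p : P) :
    (C.frame p).snd (C.hat Y p) = Y (C.proj p) :=
  (C.frame_isInvertible hE p).self_apply_inverse _

lemma eq_hat (C : CartanGeometry Λ m n E M E' P) {Y : Π x : M, TangentSpace 𝓘(ℝ, E) x} {p : P}
    {z : Z m n} (h : (C.frame p).snd z = Y (C.proj p)) : z = C.hat Y p :=
  C.frame_injective hE p (h.trans (C.frame_hat hE Y p).symm)

end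

/-- The admissible frame at `q` in the coordinates given by the chart at `π(p)`. -/
def frameCoord (C : CartanGeometry Λ m n E M E' P) (p q : P) : Z m n →L[ℝ] E :=
  (mfderiv 𝓘(ℝ, E) 𝓘(ℝ, E) (extChartAt 𝓘(ℝ, E) (C.proj p)) (C.proj q)).comp (C.frame q).snd

variable [IsManifold 𝓘(ℝ, E) ∞ M]

lemma contMDiffAt_chart_proj (C : CartanGeometry Λ m n E M E' P) (p : P) :
    ContMDiffAt 𝓘(ℝ, E') 𝓘(ℝ, E) ∞ (fun q => extChartAt 𝓘(ℝ, E) (C.proj p) (C.proj q)) p :=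
  (contMDiffAt_extChartAt (I := 𝓘(ℝ, E)) (x := C.proj p)).comp p C.smooth_proj.contMDiffAt

lemma eventually_proj_mem_source (C : CartanGeometry Λ m n E M E' P) (p : P) :
    ∀ᶠ q in 𝓝 p, C.proj q ∈ (chartAt E (C.proj p)).source :=
  C.smooth_proj.continuous.continuousAt.eventually
    ((chartAt E (C.proj p)).open_source.mem_nhds (mem_chart_source E (C.proj p)))

/-- By the chain rule, a column of the frame is a derivative of the chart functions along a constant
field. Smoothness of `φ`, and later its derivative along `X`, are deduced from this. -/
lemma frameCoord_apply (C : CartanGeometry Λ m n E M E' P) (p : P) (z : Z m n) :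
    ∀ᶠ q in 𝓝 p, C.frameCoord p q z = dirDeriv (C.constField (inclZ z))
      (fun q => extChartAt 𝓘(ℝ, E) (C.proj p) (C.proj q)) q := by
  filter_upwards [C.eventually_proj_mem_source p] with q hq
  have h1 := mfderiv_comp q (mdifferentiableAt_extChartAt (I := 𝓘(ℝ, E)) hq)
    (C.mdifferentiableAt_proj q)
  refine Eq.trans ?_ (DFunLike.congr_fun h1 (C.constField (inclZ z) q)).symm
  exact congrArg (mfderiv 𝓘(ℝ, E) 𝓘(ℝ, E) (extChartAt 𝓘(ℝ, E) (C.proj p)) (C.proj q))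
    (C.mfderiv_proj_A_symm (inclZ z) q).symm

lemma contMDiffAt_frameCoord [CompleteSpace E'] (C : CartanGeometry Λ m n E M E' P) (p : P) :
    ContMDiffAt 𝓘(ℝ, E') 𝓘(ℝ, Z m n →L[ℝ] E) ∞ (C.frameCoord p) p :=
  contMDiffAt_clm_of_apply fun z =>
    (dirDeriv_contMDiffAt (C.smoothFieldAt_constField _ p)
      (C.contMDiffAt_chart_proj p)).congr_of_eventuallyEq (C.frameCoord_apply p z)

/-- In the chart, `hat Y` solves the linear equation whose matrix is `frameCoord` and whose
right-hand side is the coordinate expression of `Y`. -/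
lemma contMDiffAt_hat [CompleteSpace E'] [FiniteDimensional ℝ E] (hE : Module.finrank ℝ E = m + n)
    (C : CartanGeometry Λ m n E M E' P) {Y : Π x : M, TangentSpace 𝓘(ℝ, E) x} {p : P}
    (hY : SmoothFieldAt Y (C.proj p)) :
    ContMDiffAt 𝓘(ℝ, E') 𝓘(ℝ, Z m n) ∞ (C.hat Y) p := by
  refine contMDiffAt_of_clm_apply_eq (C.contMDiffAt_frameCoord p) ?_
    ((dirDeriv_contMDiffAt hY contMDiffAt_extChartAt).comp p C.smooth_proj.contMDiffAt) ?_
  · exact (isInvertible_mfderiv_extChartAt (mem_extChartAt_source (I := 𝓘(ℝ, E)) _)).comp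
      (C.frame_isInvertible hE p)
  · refine Filter.Eventually.of_forall fun q => ?_
    exact congrArg (mfderiv 𝓘(ℝ, E) 𝓘(ℝ, E) (extChartAt 𝓘(ℝ, E) (C.proj p)) (C.proj q))
      (C.frame_hat hE Y q)

end CartanGeometry

/-! ### The differential of `φ` in the induced coordinates. -/

section Calculus

variable {E : Type*} [NormedAddCommGroup E] [NormedSpace ℝ E]
  {M : Type*} [TopologicalSpace M] [ChartedSpace E M]
  {F : Type*} [NormedAddCommGroup F] [NormedSpace ℝ F]

lemma mfderiv_eq_fderiv_chart {u : M → F} {x : M} (hu : MDifferentiableAt 𝓘(ℝ, E) 𝓘(ℝ, F) u x) :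
    (mfderiv 𝓘(ℝ, E) 𝓘(ℝ, F) u x : E →L[ℝ] F)
      = fderiv ℝ (u ∘ (extChartAt 𝓘(ℝ, E) x).symm) (extChartAt 𝓘(ℝ, E) x x) := by
  rw [← fderivWithin_univ]
  have h := hu.mfderiv
  rwa [modelWithCornersSelf_coe, range_id] at h

lemma differentiableAt_chart {u : M → F} {x : M} (hu : MDifferentiableAt 𝓘(ℝ, E) 𝓘(ℝ, F) u x) :
    DifferentiableAt ℝ (u ∘ (extChartAt 𝓘(ℝ, E) x).symm) (extChartAt 𝓘(ℝ, E) x x) := by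
  have h := hu.differentiableWithinAt_writtenInExtChartAt
  rw [modelWithCornersSelf_coe, range_id, differentiableWithinAt_univ] at h
  exact h

end Calculus

namespace CartanGeometry

variable {Λ : SignType} {m n : ℕ}
  {E : Type*} [NormedAddCommGroup E] [NormedSpace ℝ E]
  {M : Type*} [TopologicalSpace M] [ChartedSpace E M] [IsManifold 𝓘(ℝ, E) ∞ M]
  {E' : Type*} [NormedAddCommGroup E'] [NormedSpace ℝ E'] [CompleteSpace E']
  {P : Type*} [TopologicalSpace P] [ChartedSpace E' P] [IsManifold 𝓘(ℝ, E') ∞ P]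

/-- Over the chart domain the trivialisation of `TM` is the differential of the chart, and the
trivial factor 𝔷 contributes the identity. -/
lemma inCoordinates_frame_eventuallyEq (C : CartanGeometry Λ m n E M E' P) (p : P) :
    (fun q => ContinuousLinearMap.inCoordinates (Z m n) (fun _ : M => Z m n) E
      (TangentSpace 𝓘(ℝ, E)) (C.proj p) (C.proj q) (C.proj p) (C.proj q) (C.frame q).snd)
      =ᶠ[𝓝 p] C.frameCoord p := by
  filter_upwards [C.eventually_proj_mem_source p] with q hq
  have h1 : Trivialization.symmL ℝ (trivializationAt (Z m n) (fun _ : M => Z m n) (C.proj p))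
      (C.proj q) = ContinuousLinearMap.id ℝ (Z m n) :=
    Bundle.Trivial.symmL_trivialization ℝ M (Z m n) (C.proj q)
  simp only [ContinuousLinearMap.inCoordinates, frameCoord,
    TangentBundle.continuousLinearMapAt_trivializationAt hq, h1]
  rfl

lemma mdifferentiableAt_frame (C : CartanGeometry Λ m n E M E' P) (p : P) :
    MDifferentiableAt 𝓘(ℝ, E') (frameModel m n E) C.frame p := by
  refine ContMDiffAt.mdifferentiableAt (n := ∞) ?_ (by simp)
  refine (contMDiffAt_hom_bundle _).2 ⟨C.smooth_proj p, ?_⟩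
  exact (C.contMDiffAt_frameCoord p).congr_of_eventuallyEq (C.inCoordinates_frame_eventuallyEq p)

/-- The chart of the frame space at `φ(p)` is induced by the chart of `M` at `π(p)`; in it `φ` is
the pair of the coordinates of `π` and `frameCoord`. This is the form in which `completeLift` is
written. -/
lemma mfderiv_frame (C : CartanGeometry Λ m n E M E' P) (p : P) (w : TangentSpace 𝓘(ℝ, E') p) :
    (mfderiv 𝓘(ℝ, E') (frameModel m n E) C.frame p w : E × (Z m n →L[ℝ] E))
      = (mfderiv 𝓘(ℝ, E') 𝓘(ℝ, E) C.proj p w,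
          mfderiv 𝓘(ℝ, E') 𝓘(ℝ, Z m n →L[ℝ] E) (C.frameCoord p) p w) := by
  set φ := extChartAt 𝓘(ℝ, E') p
  have hφ : Filter.Tendsto φ.symm (𝓝 (φ p)) (𝓝 p) := by
    have := continuousAt_extChartAt_symm (I := 𝓘(ℝ, E')) p
    rwa [ContinuousAt, extChartAt_to_inv] at this
  have h0 := (C.contMDiffAt_frameCoord p).mdifferentiableAt (by simp)
  have hu := (C.contMDiffAt_chart_proj p).mdifferentiableAt (by simp)
  have e : writtenInExtChartAt 𝓘(ℝ, E') (frameModel m n E) p C.frame =ᶠ[𝓝 (φ p)]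
      fun y => (extChartAt 𝓘(ℝ, E) (C.proj p) (C.proj (φ.symm y)), C.frameCoord p (φ.symm y)) := by
    filter_upwards [hφ.eventually (C.inCoordinates_frame_eventuallyEq p)] with y hy
    refine Eq.trans ?_ (congrArg (Prod.mk _) hy)
    simp only [writtenInExtChartAt, FiberBundle.extChartAt]
    rfl
  have e1 : (mfderiv 𝓘(ℝ, E') (frameModel m n E) C.frame p : E' →L[ℝ] E × (Z m n →L[ℝ] E))
      = fderiv ℝ (fun y => (extChartAt 𝓘(ℝ, E) (C.proj p) (C.proj (φ.symm y)),
          C.frameCoord p (φ.symm y))) (φ p) := by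
    rw [← e.fderiv_eq, ← fderivWithin_univ]
    have h1 := (C.mdifferentiableAt_frame p).mfderiv
    rwa [modelWithCornersSelf_coe, range_id] at h1
  have e2 : (mfderiv 𝓘(ℝ, E') 𝓘(ℝ, E) C.proj p : E' →L[ℝ] E)
      = fderiv ℝ (fun y => extChartAt 𝓘(ℝ, E) (C.proj p) (C.proj (φ.symm y))) (φ p) := by
    rw [← fderivWithin_univ]
    have h1 := (C.mdifferentiableAt_proj p).mfderiv
    rwa [modelWithCornersSelf_coe, range_id] at h1
  have d1 : DifferentiableAt ℝ (fun y => extChartAt 𝓘(ℝ, E) (C.proj p) (C.proj (φ.symm y))) (φ p) :=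
    differentiableAt_chart hu
  have d2 : DifferentiableAt ℝ (fun y => C.frameCoord p (φ.symm y)) (φ p) :=
    differentiableAt_chart h0
  refine (DFunLike.congr_fun e1 w).trans ?_
  rw [d1.fderiv_prodMk d2]
  exact Prod.ext (DFunLike.congr_fun e2 w).symm
    (DFunLike.congr_fun (mfderiv_eq_fderiv_chart h0) w).symm

end CartanGeometry
-- Structure equation, horizontal lifts, and the metric in frames.
lemma projZ_bracket {m n : ℕ} (Λ : SignType) (a b : KleinAlgebra m n) :
    projZ (bracket Λ a b) = valO (projH a) (projZ b) - valO (projH b) (projZ a) := by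
  -- The `Λ`-term lies in 𝔥, so the torsion is the same expression for all three models.
  have h1 : ∀ h : OAlgebra m n, projZ (inclH h) = 0 := fun _ => rfl
  have h2 : ∀ z : Z m n, projZ (inclZ z) = z := fun _ => rfl
  rw [bracket, map_add, map_add, map_smul, h1, h1, h2, smul_zero, zero_add, zero_add]

namespace CartanGeometry

variable {Λ : SignType} {m n : ℕ}
  {E : Type*} [NormedAddCommGroup E] [NormedSpace ℝ E]
  {M : Type*} [TopologicalSpace M] [ChartedSpace E M] [IsManifold 𝓘(ℝ, E) ∞ M]
  {E' : Type*} [NormedAddCommGroup E'] [NormedSpace ℝ E']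
  {P : Type*} [TopologicalSpace P] [ChartedSpace E' P] [IsManifold 𝓘(ℝ, E') ∞ P]

/-- The component `e(V)` of the Cartan connection on a vector field. -/
def solder (C : CartanGeometry Λ m n E M E' P) (V : Π p : P, TangentSpace 𝓘(ℝ, E') p) (p : P) :
    Z m n :=
  projZ (C.A p (V p))

/-- The component `ω(V)` of the Cartan connection on a vector field. -/
def conn (C : CartanGeometry Λ m n E M E' P) (V : Π p : P, TangentSpace 𝓘(ℝ, E') p) (p : P) :
    Z m n →L[ℝ] Z m n :=
  valO (projH (C.A p (V p)))

lemma conn_mem_o (C : CartanGeometry Λ m n E M E' P) (V : Π p : P, TangentSpace 𝓘(ℝ, E') p)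
    (p : P) : C.conn V p ∈ o m n :=
  valO_mem _

/-- The torsion-free structure equation. -/
lemma solder_mlieBracket (C : CartanGeometry Λ m n E M E' P) (hT : C.TorsionFree)
    {V W : Π p : P, TangentSpace 𝓘(ℝ, E') p} {p : P}
    (hV : SmoothFieldAt V p) (hW : SmoothFieldAt W p) :
    C.solder (mlieBracket 𝓘(ℝ, E') V W) p
      = dirDeriv V (C.solder W) p - dirDeriv W (C.solder V) p
        + C.conn V p (C.solder W p) - C.conn W p (C.solder V p) := by
  have h := hT p V W hV hW
  have d1 : dirDeriv V (C.solder W) p = projZ (dirDeriv V (fun q => C.A q (W q)) p) :=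
    dirDeriv_clm projZ ((C.contMDiffAt_A_apply hW).mdifferentiableAt (by simp))
  have d2 : dirDeriv W (C.solder V) p = projZ (dirDeriv W (fun q => C.A q (V q)) p) :=
    dirDeriv_clm projZ ((C.contMDiffAt_A_apply hV).mdifferentiableAt (by simp))
  rw [curvature, extDerivForm, map_add, map_sub, map_sub, projZ_bracket, ← d1, ← d2] at h
  rw [add_sub_assoc, ← sub_eq_zero, ← neg_eq_zero, ← h]
  simp only [solder, conn]
  abel

/-- The horizontal lift of a vector field on `M`. -/
def lift (C : CartanGeometry Λ m n E M E' P) (Y : Π x : M, TangentSpace 𝓘(ℝ, E) x) (p : P) :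
    TangentSpace 𝓘(ℝ, E') p :=
  (C.A p).symm (inclZ (C.hat Y p))

lemma solder_lift (C : CartanGeometry Λ m n E M E' P) (Y : Π x : M, TangentSpace 𝓘(ℝ, E) x) :
    C.solder (C.lift Y) = C.hat Y := by
  funext p
  rw [solder, lift, ContinuousLinearEquiv.apply_symm_apply]
  rfl

lemma conn_lift (C : CartanGeometry Λ m n E M E' P) (Y : Π x : M, TangentSpace 𝓘(ℝ, E) x) (p : P) :
    C.conn (C.lift Y) p = 0 := by
  rw [conn, lift, ContinuousLinearEquiv.apply_symm_apply]
  rfl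

variable [FiniteDimensional ℝ E] [CompleteSpace E'] (hE : Module.finrank ℝ E = m + n)
include hE

lemma smoothFieldAt_lift (C : CartanGeometry Λ m n E M E' P)
    {Y : Π x : M, TangentSpace 𝓘(ℝ, E) x} {p : P} (hY : SmoothFieldAt Y (C.proj p)) :
    SmoothFieldAt (C.lift Y) p :=
  C.smoothFieldAt_A_symm (inclZ.contMDiff.contMDiffAt.comp p (C.contMDiffAt_hat hE hY))

lemma mfderiv_proj_lift (C : CartanGeometry Λ m n E M E' P)
    (Y : Π x : M, TangentSpace 𝓘(ℝ, E) x) (p : P) :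
    mfderiv 𝓘(ℝ, E') 𝓘(ℝ, E) C.proj p (C.lift Y p) = Y (C.proj p) :=
  (C.mfderiv_proj_A_symm _ p).trans (C.frame_hat hE Y p)

lemma solder_eq_hat (C : CartanGeometry Λ m n E M E' P) {V : Π p : P, TangentSpace 𝓘(ℝ, E') p}
    {v : Π x : M, TangentSpace 𝓘(ℝ, E) x} {p : P}
    (h : mfderiv 𝓘(ℝ, E') 𝓘(ℝ, E) C.proj p (V p) = v (C.proj p)) : C.solder V p = C.hat v p :=
  C.eq_hat hE ((C.frame_apply p (V p)).trans h)

lemma solder_mlieBracket_of_related (C : CartanGeometry Λ m n E M E' P)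
    {V W : Π p : P, TangentSpace 𝓘(ℝ, E') p} {v w : Π x : M, TangentSpace 𝓘(ℝ, E) x} {p : P}
    (hV : SmoothFieldAt V p) (hW : SmoothFieldAt W p)
    (hv : SmoothFieldAt v (C.proj p)) (hw : SmoothFieldAt w (C.proj p))
    (hVv : ∀ q, mfderiv 𝓘(ℝ, E') 𝓘(ℝ, E) C.proj q (V q) = v (C.proj q))
    (hWw : ∀ q, mfderiv 𝓘(ℝ, E') 𝓘(ℝ, E) C.proj q (W q) = w (C.proj q)) :
    C.solder (mlieBracket 𝓘(ℝ, E') V W) p = C.hat (mlieBracket 𝓘(ℝ, E) v w) p := by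
  have := FiniteDimensional.complete ℝ E
  exact C.solder_eq_hat hE (mfderiv_mlieBracket_of_related C.smooth_proj hV hW hv hw hVv hWw)

lemma metric_eq_eta_hat (C : CartanGeometry Λ m n E M E' P)
    (Y W : Π x : M, TangentSpace 𝓘(ℝ, E) x) (p : P) :
    C.metric (C.proj p) (Y (C.proj p)) (W (C.proj p)) = eta (C.hat Y p) (C.hat W p) := by
  rw [← C.metric_frame hE p, C.frame_hat hE, C.frame_hat hE]

/-- The point of `P` chosen in `metric` need not vary continuously. A smooth local section replaces
it, since every admissible frame gives the same metric. -/
lemma contMDiffAt_metric (C : CartanGeometry Λ m n E M E' P)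
    {Y W : Π x : M, TangentSpace 𝓘(ℝ, E) x} {x : M}
    (hY : SmoothFieldAt Y x) (hW : SmoothFieldAt W x) :
    ContMDiffAt 𝓘(ℝ, E) 𝓘(ℝ, ℝ) ∞ (fun y => C.metric y (Y y) (W y)) x := by
  obtain ⟨U, s, τ, hU, hx, hs, -, hs', -⟩ := C.locally_trivial x
  have hsx := hs' x hx
  have h1 : ContMDiffAt 𝓘(ℝ, E') 𝓘(ℝ, ℝ) ∞ (fun q => eta (C.hat Y q) (C.hat W q)) (s x) :=
    contMDiffAt_eta (C.contMDiffAt_hat hE (by rwa [hsx])) (C.contMDiffAt_hat hE (by rwa [hsx]))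
  refine (h1.comp x (hs.contMDiffAt (hU.mem_nhds hx))).congr_of_eventuallyEq ?_
  filter_upwards [hU.mem_nhds hx] with y hy
  have h2 := C.metric_eq_eta_hat hE Y W (s y)
  rw [hs' y hy] at h2
  exact h2

/-- The Lie derivative of the associated metric in admissible frames. -/
lemma lieDerivMetric_eq (C : CartanGeometry Λ m n E M E' P)
    {V : Π p : P, TangentSpace 𝓘(ℝ, E') p} {ξ Y W : Π x : M, TangentSpace 𝓘(ℝ, E) x} {p : P}
    (hV : mfderiv 𝓘(ℝ, E') 𝓘(ℝ, E) C.proj p (V p) = ξ (C.proj p))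
    (hY : SmoothFieldAt Y (C.proj p)) (hW : SmoothFieldAt W (C.proj p)) :
    lieDerivMetric ξ C.metric Y W (C.proj p)
      = eta (dirDeriv V (C.hat Y) p - C.hat (mlieBracket 𝓘(ℝ, E) ξ Y) p) (C.hat W p)
        + eta (C.hat Y p) (dirDeriv V (C.hat W) p - C.hat (mlieBracket 𝓘(ℝ, E) ξ W) p) := by
  have h1 := dirDeriv_comp_of_related (C.mdifferentiableAt_proj p)
    ((C.contMDiffAt_metric hE hY hW).mdifferentiableAt (by simp)) hV
  simp only [C.metric_eq_eta_hat hE] at h1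
  rw [dirDeriv_eta ((C.contMDiffAt_hat hE hY).mdifferentiableAt (by simp))
    ((C.contMDiffAt_hat hE hW).mdifferentiableAt (by simp))] at h1
  rw [lieDerivMetric, ← h1, C.metric_eq_eta_hat hE (mlieBracket 𝓘(ℝ, E) ξ Y) W,
    C.metric_eq_eta_hat hE Y (mlieBracket 𝓘(ℝ, E) ξ W)]
  simp only [← etaL_apply, map_sub, sub_apply]
  ring

/-- A Cartan geometry invariant under `ξ` has an associated metric invariant under `ξ`. -/
lemma IsInvariant.isKilling [FiniteDimensional ℝ E'] {C : CartanGeometry Λ m n E M E' P}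
    {ξ : Π x : M, TangentSpace 𝓘(ℝ, E) x}
    (hξ : SmoothField ξ) (h : C.IsInvariant ξ) : IsKilling ξ C.metric := by
  obtain ⟨X, hX, hframe, hA⟩ := h
  have hrel : ∀ q, mfderiv 𝓘(ℝ, E') 𝓘(ℝ, E) C.proj q (X q) = ξ (C.proj q) := fun q =>
    congrArg Prod.fst ((C.mfderiv_frame q (X q)).symm.trans (hframe q))
  intro x Y W hY hW
  obtain ⟨p, rfl⟩ := C.proj_surjective x
  -- The 𝔷-part of `L_X A = 0` on the horizontal lift, where `e(lift Y) = hat Y` and the bracket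
  -- projects to `[ξ, Y]`.
  have key : ∀ {Y : Π x : M, TangentSpace 𝓘(ℝ, E) x}, SmoothFieldAt Y (C.proj p) →
      dirDeriv X (C.hat Y) p - C.hat (mlieBracket 𝓘(ℝ, E) ξ Y) p = 0 := by
    intro Y hY
    have hL := C.smoothFieldAt_lift hE hY
    have h1 := congrArg projZ (hA p _ hL)
    rw [lieDerivForm, map_sub, ← dirDeriv_clm projZ
      ((C.contMDiffAt_A_apply hL).mdifferentiableAt (by simp)), map_zero] at h1
    rw [← C.solder_mlieBracket_of_related hE (hX p) hL (hξ _) hY hrel (C.mfderiv_proj_lift hE Y),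
      ← C.solder_lift Y]
    exact h1
  rw [C.lieDerivMetric_eq hE (hrel p) hY hW, key hY, key hW]
  simp [← etaL_apply]

end CartanGeometry
-- Nondegeneracy of `η` and rigidity of 𝔬(m,n).
lemma eta_eq_zero_of_forall {m n : ℕ} {z : Z m n} (h : ∀ w, eta z w = 0) : z = 0 := by
  ext i
  rcases i with i | j
  · simpa [eta] using h (EuclideanSpace.single (Sum.inl i) 1)
  · simpa [eta] using h (EuclideanSpace.single (Sum.inr j) 1)

/-- A linear map to `𝔬(m,n)` that is symmetric in its two arguments vanishes. -/
lemma eq_zero_of_symm_of_skew {m n : ℕ} {v : Z m n → Z m n →L[ℝ] Z m n}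
    (hs : ∀ a b, v a b = v b a) (ho : ∀ a, v a ∈ o m n) (a : Z m n) : v a = 0 := by
  have flip : ∀ a b c, eta (v a b) c = - eta (v a c) b := fun a b c => by
    have := ho a b c
    rw [eta_comm b] at this
    linarith
  ext1 b
  refine eta_eq_zero_of_forall fun c => ?_
  -- Alternating skewness and symmetry three times returns `η(v a b, c)` to itself with the opposite
  -- sign.
  have e1 := flip a b c
  have e2 := flip c a b
  have e3 := flip b c a
  rw [hs a c] at e1
  rw [hs c b] at e2
  rw [hs b a] at e3
  linarith

/-! ### Lifting a Killing field to `P`. -/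

namespace CartanGeometry

variable {Λ : SignType} {m n : ℕ}
  {E : Type*} [NormedAddCommGroup E] [NormedSpace ℝ E]
  {M : Type*} [TopologicalSpace M] [ChartedSpace E M] [IsManifold 𝓘(ℝ, E) ∞ M]
  {E' : Type*} [NormedAddCommGroup E'] [NormedSpace ℝ E']
  {P : Type*} [TopologicalSpace P] [ChartedSpace E' P] [IsManifold 𝓘(ℝ, E') ∞ P]

/-- The covariant derivative of a vector field on `M`, read in an admissible frame. -/
def covDeriv (C : CartanGeometry Λ m n E M E' P) (ξ : Π x : M, TangentSpace 𝓘(ℝ, E) x) (p : P) :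
    Z m n →L[ℝ] Z m n :=
  (mfderiv 𝓘(ℝ, E') 𝓘(ℝ, Z m n) (C.hat ξ) p).comp
    (((C.A p).symm : KleinAlgebra m n →L[ℝ] TangentSpace 𝓘(ℝ, E') p).comp inclZ)

lemma dirDeriv_lift_hat (C : CartanGeometry Λ m n E M E' P)
    (ξ Y : Π x : M, TangentSpace 𝓘(ℝ, E) x) (p : P) :
    dirDeriv (C.lift Y) (C.hat ξ) p = C.covDeriv ξ p (C.hat Y p) :=
  rfl

lemma solder_constField (C : CartanGeometry Λ m n E M E' P) (a : KleinAlgebra m n) (p : P) :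
    C.solder (C.constField a) p = projZ a := by
  rw [solder, A_constField]

lemma conn_constField (C : CartanGeometry Λ m n E M E' P) (a : KleinAlgebra m n) (p : P) :
    C.conn (C.constField a) p = valO (projH a) := by
  rw [conn, A_constField]

/-- The Lie derivative of `A` vanishes along a vector field commuting with the constant fields. -/
lemma lieDerivForm_A_eq_zero [CompleteSpace E'] (C : CartanGeometry Λ m n E M E' P)
    {X : Π p : P, TangentSpace 𝓘(ℝ, E') p} {p : P}
    (h : ∀ a, mlieBracket 𝓘(ℝ, E') X (C.constField a) p = 0)
    {Y : Π p : P, TangentSpace 𝓘(ℝ, E') p} (hY : SmoothFieldAt Y p) :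
    lieDerivForm X (fun q w => C.A q w) Y p = 0 := by
  let b := Module.finBasis ℝ (KleinAlgebra m n)
  let L : ∀ i, KleinAlgebra m n →L[ℝ] ℝ := fun i => LinearMap.toContinuousLinearMap (b.coord i)
  let c : Fin (Module.finrank ℝ (KleinAlgebra m n)) → P → ℝ := fun i q => L i (C.A q (Y q))
  have hA := C.contMDiffAt_A_apply hY
  have hc : ∀ i, ContMDiffAt 𝓘(ℝ, E') 𝓘(ℝ, ℝ) ∞ (c i) p := fun i =>
    (L i).contMDiff.contMDiffAt.comp p hA
  have e : Y = ∑ i, c i • C.constField (b i) := by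
    funext q
    apply (C.A q).injective
    rw [Finset.sum_apply, map_sum]
    conv_lhs => rw [← b.sum_repr (C.A q (Y q))]
    refine Finset.sum_congr rfl fun i _ => ?_
    rw [Pi.smul_apply', map_smul, A_constField]
    rfl
  -- Since the brackets with constant fields vanish, only the derivatives of the coefficients
  -- survive.
  have h1 : C.A p (mlieBracket 𝓘(ℝ, E') X Y p) = ∑ i, dirDeriv X (c i) p • b i := by
    conv_lhs => rw [e]
    rw [mlieBracket_sum_smul_right _ hc fun i => C.smoothFieldAt_constField (b i) p, map_sum]
    refine Finset.sum_congr rfl fun i _ => ?_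
    rw [h, smul_zero, add_zero, map_smul, A_constField]
  rw [lieDerivForm, h1, sub_eq_zero, ← b.sum_repr (dirDeriv X (fun q => C.A q (Y q)) p)]
  refine Finset.sum_congr rfl fun i _ => ?_
  congr 1
  exact (dirDeriv_clm (L i) (hA.mdifferentiableAt (by simp))).symm

/-- A vector field on `P` that lifts `ξ` and commutes with the constant fields is mapped by `φ` to
the complete lift of `ξ`. -/
lemma mfderiv_frame_eq_completeLift [CompleteSpace E'] (C : CartanGeometry Λ m n E M E' P)
    {ξ : Π x : M, TangentSpace 𝓘(ℝ, E) x} (hξ : SmoothField ξ)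
    {X : Π p : P, TangentSpace 𝓘(ℝ, E') p} (hX : SmoothField X)
    (hrel : ∀ q, mfderiv 𝓘(ℝ, E') 𝓘(ℝ, E) C.proj q (X q) = ξ (C.proj q)) {p : P}
    (h : ∀ a, mlieBracket 𝓘(ℝ, E') X (C.constField a) p = 0) :
    mfderiv 𝓘(ℝ, E') (frameModel m n E) C.frame p (X p) = completeLift ξ (C.frame p) := by
  refine (C.mfderiv_frame p (X p)).trans (Prod.ext (hrel p) ?_)
  refine ContinuousLinearMap.ext fun z : Z m n => ?_
  set u : M → E := ⇑(extChartAt 𝓘(ℝ, E) (C.proj p)) with hu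
  have hus : ContMDiffAt 𝓘(ℝ, E) 𝓘(ℝ, E) ∞ u (C.proj p) := contMDiffAt_extChartAt
  have hY := C.smoothFieldAt_constField (inclZ z) p
  have d0 := (C.contMDiffAt_frameCoord p).mdifferentiableAt (by simp)
  have e1 : ContinuousLinearMap.apply ℝ E z
        (mfderiv 𝓘(ℝ, E') 𝓘(ℝ, Z m n →L[ℝ] E) (C.frameCoord p) p (X p))
      = dirDeriv X (fun q => C.frameCoord p q z) p :=
    (dirDeriv_clm (ContinuousLinearMap.apply ℝ E z) d0).symm
  have e2 : dirDeriv X (fun q => C.frameCoord p q z) p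
      = dirDeriv X (dirDeriv (C.constField (inclZ z)) (fun q => u (C.proj q))) p :=
    dirDeriv_congr_of_eventuallyEq (C.frameCoord_apply p z)
  have e3 := dirDeriv_mlieBracket (hX p) hY (C.contMDiffAt_chart_proj p)
  have e4 : dirDeriv (mlieBracket 𝓘(ℝ, E') X (C.constField (inclZ z)))
      (fun q => u (C.proj q)) p = 0 := by
    rw [dirDeriv, h, map_zero]; rfl
  have e5 : dirDeriv (C.constField (inclZ z)) (dirDeriv X (fun q => u (C.proj q))) p
      = dirDeriv (C.constField (inclZ z)) (fun q => dirDeriv ξ u (C.proj q)) p :=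
    dirDeriv_congr_of_eventuallyEq (dirDeriv_comp_related_eventuallyEq C.smooth_proj hus hrel)
  have dξ := (dirDeriv_contMDiffAt (hξ (C.proj p)) hus).mdifferentiableAt (n := ∞) (by simp)
  have e6 : dirDeriv (C.constField (inclZ z)) (fun q => dirDeriv ξ u (C.proj q)) p
      = mfderiv 𝓘(ℝ, E) 𝓘(ℝ, E) (dirDeriv ξ u) (C.proj p) ((C.frame p).snd z) := by
    have := mfderiv_comp p dξ (C.mdifferentiableAt_proj p)
    refine (DFunLike.congr_fun this (C.constField (inclZ z) p)).trans ?_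
    exact congrArg (mfderiv 𝓘(ℝ, E) 𝓘(ℝ, E) (dirDeriv ξ u) (C.proj p))
      (C.mfderiv_proj_A_symm (inclZ z) p)
  -- The derivative of the coordinate functions along `ξ` is the coordinate expression of `ξ`. Its
  -- differential supplies the `∂_b ξ^a` of the complete lift.
  have e7 : (dirDeriv ξ u) ∘ (extChartAt 𝓘(ℝ, E) (C.proj p)).symm
      =ᶠ[𝓝 (extChartAt 𝓘(ℝ, E) (C.proj p) (C.proj p))]
      (mpullback 𝓘(ℝ, E) 𝓘(ℝ, E) (extChartAt 𝓘(ℝ, E) (C.proj p)).symm ξ : E → E) := by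
    filter_upwards [dirDeriv_chart (X := ξ) (hus.of_le (by simp)),
      (isOpen_extChartAt_target (I := 𝓘(ℝ, E)) (C.proj p)).mem_nhds (mem_extChartAt_target _)]
      with y hy hyt
    have hid : u ∘ (extChartAt 𝓘(ℝ, E) (C.proj p)).symm =ᶠ[𝓝 y] id := by
      filter_upwards [(isOpen_extChartAt_target (I := 𝓘(ℝ, E)) (C.proj p)).mem_nhds hyt] with y' hy'
      exact (extChartAt 𝓘(ℝ, E) (C.proj p)).right_inv hy'
    rw [hid.fderiv_eq, fderiv_id] at hy
    exact hy
  have e8 := DFunLike.congr_fun ((mfderiv_eq_fderiv_chart dξ).trans e7.fderiv_eq)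
    ((C.frame p).snd z)
  refine e1.trans (e2.trans (Eq.trans ?_ (e5.trans (e6.trans e8))))
  -- The two orders of differentiation by `X` and the constant field differ by their bracket, which
  -- is zero.
  rw [← sub_eq_zero]
  exact e3.symm.trans e4

variable [FiniteDimensional ℝ E] [CompleteSpace E'] (hE : Module.finrank ℝ E = m + n)
include hE

lemma contMDiffAt_covDeriv (C : CartanGeometry Λ m n E M E' P)
    {ξ : Π x : M, TangentSpace 𝓘(ℝ, E) x} (hξ : SmoothField ξ) (p : P) :
    ContMDiffAt 𝓘(ℝ, E') 𝓘(ℝ, Z m n →L[ℝ] Z m n) ∞ (C.covDeriv ξ) p :=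
  contMDiffAt_clm_of_apply fun z =>
    dirDeriv_contMDiffAt (C.smoothFieldAt_constField (inclZ z) p) (C.contMDiffAt_hat hE (hξ _))

/-- The covariant derivative of a Killing vector field is skew. -/
lemma covDeriv_mem_o (C : CartanGeometry Λ m n E M E' P) (hT : C.TorsionFree)
    {ξ : Π x : M, TangentSpace 𝓘(ℝ, E) x} (hξ : SmoothField ξ) (hK : IsKilling ξ C.metric) (p : P) :
    C.covDeriv ξ p ∈ o m n := by
  intro z w
  -- Any smooth extension of the vector will do: the derivative terms combine into a tensorial
  -- expression.
  let Y : Z m n → Π x : M, TangentSpace 𝓘(ℝ, E) x := fun z =>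
    FiberBundle.extend E ((C.frame p).snd z : TangentSpace 𝓘(ℝ, E) (C.proj p))
  have hY : ∀ z, SmoothFieldAt (Y z) (C.proj p) := fun z =>
    FiberBundle.contMDiffAt_extend 𝓘(ℝ, E) E _
  have hz : ∀ z, C.hat (Y z) p = z := fun z =>
    (C.eq_hat hE (FiberBundle.extend_apply_self _ _).symm).symm
  have hξl := C.smoothFieldAt_lift hE (hξ (C.proj p))
  -- For horizontal lifts the `ω`-terms of the structure equation vanish, leaving the derivative of
  -- `hat ξ` along the lift of `Y z`.
  have key : ∀ z, dirDeriv (C.lift ξ) (C.hat (Y z)) p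
      - C.hat (mlieBracket 𝓘(ℝ, E) ξ (Y z)) p = C.covDeriv ξ p z := by
    intro z
    have hYl := C.smoothFieldAt_lift hE (hY z)
    rw [← C.solder_mlieBracket_of_related hE hξl hYl (hξ _) (hY z) (C.mfderiv_proj_lift hE ξ)
      (C.mfderiv_proj_lift hE (Y z)), C.solder_mlieBracket hT hξl hYl, conn_lift, conn_lift,
      solder_lift, solder_lift, dirDeriv_lift_hat C ξ (Y z), hz]
    simp
  have h := hK (C.proj p) (Y z) (Y w) (hY z) (hY w)
  rwa [C.lieDerivMetric_eq hE (C.mfderiv_proj_lift hE ξ p) (hY z) (hY w), key, key, hz, hz] at h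

/-- The derivative of the frame components of a vector field along the fundamental vector fields. -/
lemma dirDeriv_vertical_hat (C : CartanGeometry Λ m n E M E' P) (hT : C.TorsionFree)
    {ξ : Π x : M, TangentSpace 𝓘(ℝ, E) x} (hξ : SmoothField ξ) (h : OAlgebra m n) (p : P) :
    dirDeriv (C.constField (inclH h)) (C.hat ξ) p = - valO h (C.hat ξ p) := by
  have hl := C.smoothFieldAt_lift hE (hξ (C.proj p))
  have hc := C.smoothFieldAt_constField (inclH h) p
  have h0 : SmoothFieldAt (0 : Π x : M, TangentSpace 𝓘(ℝ, E) x) (C.proj p) :=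
    contMDiffAt_zeroSection _ _
  -- The vertical field is related to the zero field on `M`, so its bracket with the lift has no
  -- `e`-part.
  have h1 := C.solder_mlieBracket_of_related hE hc hl h0 (hξ _)
    (fun q => C.mfderiv_proj_vertical h q) (C.mfderiv_proj_lift hE ξ)
  have h2 : C.hat 0 p = 0 := map_zero _
  have h3 : C.solder (C.constField (inclH h)) = fun _ => 0 := funext fun q =>
    C.solder_constField _ q
  rw [mlieBracket_zero_left, h2, C.solder_mlieBracket hT hc hl, conn_lift, solder_lift, h3,
    dirDeriv_const, conn_constField] at h1
  simp only [sub_zero, zero_apply] at h1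
  exact eq_neg_of_add_eq_zero_left h1

/-- The derivative of the frame components of a vector field along any vector field. -/
lemma dirDeriv_hat (C : CartanGeometry Λ m n E M E' P) (hT : C.TorsionFree)
    {ξ : Π x : M, TangentSpace 𝓘(ℝ, E) x} (hξ : SmoothField ξ)
    (V : Π p : P, TangentSpace 𝓘(ℝ, E') p) (p : P) :
    dirDeriv V (C.hat ξ) p = C.covDeriv ξ p (C.solder V p) - C.conn V p (C.hat ξ p) := by
  have h1 : V p = (C.A p).symm (inclH (projH (C.A p (V p))))
      + (C.A p).symm (inclZ (projZ (C.A p (V p)))) := by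
    rw [← map_add, inclH_add_inclZ, ContinuousLinearEquiv.symm_apply_apply]
  have h2 := C.dirDeriv_vertical_hat hE hT hξ (projH (C.A p (V p))) p
  have h3 : dirDeriv V (C.hat ξ) p
      = dirDeriv (C.constField (inclH (projH (C.A p (V p))))) (C.hat ξ) p
      + C.covDeriv ξ p (C.solder V p) :=
    (congrArg (mfderiv 𝓘(ℝ, E') 𝓘(ℝ, Z m n) (C.hat ξ) p) h1).trans (map_add _ _ _)
  rw [h3, h2, conn]
  abel

/-- The lift of a Killing vector field `ξ` to `P`. -/
lemma exists_killingLift (C : CartanGeometry Λ m n E M E' P) (hT : C.TorsionFree)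
    {ξ : Π x : M, TangentSpace 𝓘(ℝ, E) x} (hξ : SmoothField ξ) (hK : IsKilling ξ C.metric) :
    ∃ X : Π p : P, TangentSpace 𝓘(ℝ, E') p, SmoothField X ∧
      C.solder X = C.hat ξ ∧ C.conn X = C.covDeriv ξ := by
  -- A linear retraction onto 𝔥 turns smoothness of `covDeriv ξ` as an endomorphism into smoothness
  -- as an 𝔥-valued function.
  obtain ⟨r, hr⟩ : ∃ r : (Z m n →L[ℝ] Z m n) →L[ℝ] OAlgebra m n,
      r.comp valO = ContinuousLinearMap.id ℝ (OAlgebra m n) := by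
    obtain ⟨r, hr⟩ := (valO (m := m) (n := n)).toLinearMap.exists_leftInverse_of_injective
      (LinearMap.ker_eq_bot.2 Subtype.val_injective)
    exact ⟨LinearMap.toContinuousLinearMap r,
      ContinuousLinearMap.ext fun h => DFunLike.congr_fun hr h⟩
  let H : P → OAlgebra m n := fun p => mkO (C.covDeriv ξ p) (C.covDeriv_mem_o hE hT hξ hK p)
  have hH : ∀ p, H p = r (C.covDeriv ξ p) := fun p => (DFunLike.congr_fun hr (H p)).symm
  refine ⟨fun p => (C.A p).symm (inclH (H p) + inclZ (C.hat ξ p)), fun p => ?_, ?_, ?_⟩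
  · refine C.smoothFieldAt_A_symm ?_
    simp only [hH]
    exact ((inclH.comp r).contMDiff.contMDiffAt.comp p (C.contMDiffAt_covDeriv hE hξ p)).add
      (inclZ.contMDiff.contMDiffAt.comp p (C.contMDiffAt_hat hE (hξ _)))
  · funext p
    rw [solder, ContinuousLinearEquiv.apply_symm_apply]
    exact zero_add _
  · funext p
    rw [conn, ContinuousLinearEquiv.apply_symm_apply]
    exact congrArg valO (add_zero (H p))

/-- `e([X, V]) = X(e(V))` for the lift `X` of a Killing vector field. -/
lemma solder_mlieBracket_killingLift (C : CartanGeometry Λ m n E M E' P) (hT : C.TorsionFree)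
    {ξ : Π x : M, TangentSpace 𝓘(ℝ, E) x} (hξ : SmoothField ξ)
    {X V : Π p : P, TangentSpace 𝓘(ℝ, E') p} {p : P} (hX : SmoothField X)
    (hs : C.solder X = C.hat ξ) (hc : C.conn X = C.covDeriv ξ) (hV : SmoothFieldAt V p) :
    C.solder (mlieBracket 𝓘(ℝ, E') X V) p = dirDeriv X (C.solder V) p := by
  -- Expanding `V(hat ξ)` cancels both `ω`-terms; this is what the choice `ω(X) = covDeriv ξ`
  -- achieves.
  rw [C.solder_mlieBracket hT (hX p) hV, hs, hc, C.dirDeriv_hat hE hT hξ]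
  abel

/-- The lift of a Killing vector field commutes with the constant vector fields. -/
lemma mlieBracket_killingLift_constField (C : CartanGeometry Λ m n E M E' P) (hT : C.TorsionFree)
    {ξ : Π x : M, TangentSpace 𝓘(ℝ, E) x} (hξ : SmoothField ξ)
    {X : Π p : P, TangentSpace 𝓘(ℝ, E') p} (hX : SmoothField X)
    (hs : C.solder X = C.hat ξ) (hc : C.conn X = C.covDeriv ξ) (a : KleinAlgebra m n) (p : P) :
    mlieBracket 𝓘(ℝ, E') X (C.constField a) p = 0 := by
  have hY := C.smoothFieldAt_constField
  have hsol : ∀ a, C.solder (C.constField a) = fun _ => projZ a := fun a =>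
    funext (C.solder_constField a)
  have hbr : ∀ a q, SmoothFieldAt (mlieBracket 𝓘(ℝ, E') X (C.constField a)) q := fun a q =>
    (hX q).mlieBracket (hY a q)
  have hvert : ∀ a, C.solder (mlieBracket 𝓘(ℝ, E') X (C.constField a)) = fun _ => 0 := by
    intro a
    funext q
    rw [C.solder_mlieBracket_killingLift hE hT hξ hX hs hc (hY a q), hsol, dirDeriv_const]
  -- This `e`-part is a constant function, so its derivative along `X` will vanish.
  have hcc : ∀ a b, C.solder (mlieBracket 𝓘(ℝ, E') (C.constField a) (C.constField b))
      = fun _ => valO (projH a) (projZ b) - valO (projH b) (projZ a) := by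
    intro a b
    funext q
    rw [C.solder_mlieBracket hT (hY a q) (hY b q), hsol, hsol, dirDeriv_const, dirDeriv_const,
      conn_constField, conn_constField]
    abel
  have hright : ∀ a b, C.solder (mlieBracket 𝓘(ℝ, E') (mlieBracket 𝓘(ℝ, E') X (C.constField a))
      (C.constField b)) p = C.conn (mlieBracket 𝓘(ℝ, E') X (C.constField a)) p (projZ b) := by
    intro a b
    rw [C.solder_mlieBracket hT (hbr a p) (hY b p), hvert, hsol, dirDeriv_const, dirDeriv_const,
      map_zero]
    abel
  let v : KleinAlgebra m n → Z m n →L[ℝ] Z m n := fun a =>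
    C.conn (mlieBracket 𝓘(ℝ, E') X (C.constField a)) p
  -- The `e`-part of the Jacobi identity for `X` and two constant fields: the left side vanishes by
  -- `hcc`, the right side is `v a (projZ b) - v b (projZ a)`.
  have hv : ∀ a b, v a (projZ b) = v b (projZ a) := by
    intro a b
    have j := mlieBracket_jacobi (hX p) (hY a p) (hY b p)
    have j1 := congrArg (fun w => projZ (C.A p w)) j
    simp only [map_add] at j1
    have j2 : C.solder (mlieBracket 𝓘(ℝ, E') X
        (mlieBracket 𝓘(ℝ, E') (C.constField a) (C.constField b))) p = 0 := by
      rw [C.solder_mlieBracket_killingLift hE hT hξ hX hs hc ((hY a p).mlieBracket (hY b p)), hcc,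
        dirDeriv_const]
    have j3 : C.solder (mlieBracket 𝓘(ℝ, E') (C.constField a)
        (mlieBracket 𝓘(ℝ, E') X (C.constField b))) p = - v b (projZ a) := by
      rw [← hright b a, solder, mlieBracket_swap_apply, map_neg, map_neg]; rfl
    have j4 := j2.symm.trans (j1.trans (congrArg₂ (· + ·) (hright a b) j3))
    exact (add_neg_eq_zero.1 j4.symm)
  have hv1 : ∀ z, v (inclZ z) = 0 :=
    eq_zero_of_symm_of_skew (v := fun z => v (inclZ z)) (fun z w => hv (inclZ z) (inclZ w))
      fun z => C.conn_mem_o _ p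
  -- Taking the second argument in 𝔷 reduces a general `a`, including its 𝔥-part, to `hv1`.
  have hv0 : v a = 0 := by
    ext1 z
    have := hv a (inclZ z)
    rw [hv1] at this
    exact this
  have e1 : projZ (C.A p (mlieBracket 𝓘(ℝ, E') X (C.constField a) p)) = 0 := congrFun (hvert a) p
  have e2 : projH (C.A p (mlieBracket 𝓘(ℝ, E') X (C.constField a) p)) = 0 := Subtype.ext hv0
  apply (C.A p).injective
  rw [← inclH_add_inclZ (C.A p _), e1, e2, map_zero, map_zero, map_zero, add_zero]

end CartanGeometry

end OrthogonalCartan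

end

theorem mainTheorem5 (Λ : SignType) (m n : ℕ)
    {E : Type*} [NormedAddCommGroup E] [NormedSpace ℝ E] [FiniteDimensional ℝ E]
    (hE : Module.finrank ℝ E = m + n)
    {M : Type*} [TopologicalSpace M] [ChartedSpace E M] [IsManifold 𝓘(ℝ, E) ∞ M]
    {E' : Type*} [NormedAddCommGroup E'] [NormedSpace ℝ E'] [FiniteDimensional ℝ E']
    {P : Type*} [TopologicalSpace P] [ChartedSpace E' P] [IsManifold 𝓘(ℝ, E') ∞ P]
    (C : OrthogonalCartan.CartanGeometry Λ m n E M E' P) (hT : C.TorsionFree)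
    (ξ : Π x : M, TangentSpace 𝓘(ℝ, E) x) (hξ : OrthogonalCartan.SmoothField ξ) :
    C.IsInvariant ξ ↔ OrthogonalCartan.IsKilling ξ C.metric := by
  have := FiniteDimensional.complete ℝ E'
  refine ⟨fun h => h.isKilling hE hξ, fun hK => ?_⟩
  obtain ⟨X, hX, hs, hc⟩ := C.exists_killingLift hE hT hξ hK
  have hrel : ∀ q, mfderiv 𝓘(ℝ, E') 𝓘(ℝ, E) C.proj q (X q) = ξ (C.proj q) := fun q =>
    (C.frame_apply q (X q)).symm.trans
      ((congrArg (C.frame q).snd (congrFun hs q)).trans (C.frame_hat hE ξ q))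
  have hcomm := C.mlieBracket_killingLift_constField hE hT hξ hX hs hc
  exact ⟨X, hX, fun p => C.mfderiv_frame_eq_completeLift hξ hX hrel fun a => hcomm a p,
    fun p Y hY => C.lieDerivForm_A_eq_zero (fun a => hcomm a p) hY⟩
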